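/- Let $k\ge 1$, let $H_1,\dots,H_k$ be finite-dimensional complex Hilbert spaces of arbitrary dimensions $n_j=\dim H_j$, let $\mathcal H=H_1\otimes\cdots\otimes H_k$, and let $LU=U(H_1)\times\cdots\times U(H_k)$ act on $\mathcal H$ and on $S^2(\mathcal H)$ in the natural way. Realise $S^2(E)$ and $\Lambda^2(E)$ as the symmetric and antisymmetric tensors in $E\otimes E$, with $xy=\frac12(x\otimes y+y\otimes x)$ and, on $S^2(\mathcal H)$, the inner product inherited from $\mathcal H\otimes\mathcal H$ (so that $\|\psi^2\|=\|\psi\|^2$). For $A\subseteq[k]=\{1,\dots,k\}$ with $|A|$ even let $V_A\subseteq S^2(\mathcal H)$ be the subspace of those symmetric tensors which, under the identification $\mathcal H\otimes\mathcal H\cong\bigotimes_j(H_j\otimes H_j)$, lie in $\bigotimes_{j\notin A}S^2(H_j)\otimes\bigotimes_{j\in A}\Lambda^2(H_j)$. For each $j$ let $(e_{j,i})_{1\le i\le n_j}$ be an arbitrary orthonormal basis of $H_j$, put $e_{i_1\ldots i_k}=e_{1,i_1}\otimes\cdots\otimes e_{k,i_k}$, and let $\psi_{i_1\ldots i_k}$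 be the coefficients of $\psi\in\mathcal H$ in this basis. Then the following hold. 1. (Decomposition.) For every even-size $A$, the identification above restricts to an isomorphism of $LU$-representations $V_A\cong\bigotimes_{j\notin A}S^2(H_j)\otimes\bigotimes_{j\in A}\Lambda^2(H_j)$. $S^2(\mathcal H)$ is the orthogonal direct sum of the $V_A$ over all even-size $A\subseteq[k]$. $V_A\neq0$ if and only if $n_j\ge1$ for all $j$ and $n_j\ge2$ for all $j\in A$. The nonzero $V_A$ are irreducible and pairwise inequivalent, every irreducible subrepresentation of $S^2(\mathcal H)$ equals $V_A$ for exactly one even-size $A$, and each of them occurs in $S^2(\mathcal H)$ with multiplicity one. 2. (Orthogonal basis.) Let $|A|$ be even. For indices $1\le i_{0,j}\le i_{1,j}\le n_j$ ($1\le j\le k$) with $i_{0,j}\ne i_{1,j}$ whenever $j\in A$, put $$v=\sum_{b_1,\dots,b_k=0}^1(-1)^{|A\cap B|}\,e_{i_{b_1,1}\ldots i_{b_k,k}}\,e_{i_{1-b_1,1}\ldots i_{1-b_k,k}},\qquad B=\{j: b_j=1\}.$$ These vectors lie in $V_A$, are pairwise orthogonal and form a basis of $V_A$, and $\|v\|^2=2^{k+c}$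 with $c=|\{j: i_{0,j}=i_{1,j}\}|$. In particular $\dim V_A=\prod_{j\notin A}\binom{n_j+1}{2}\prod_{j\in A}\binom{n_j}{2}$. 3. (Invariants.) For $|A|$ even let $P_A$ be the orthogonal projection of $S^2(\mathcal H)$ onto $V_A$ and $I_A(\psi)=\langle\psi^2,P_A\psi^2\rangle$. Then, with $B$ and $c$ as above, $$I_A(\psi)=2^{-k}\sum_{1\le i_{0,j}\le i_{1,j}\le n_j\ (1\le j\le k)}2^{-c}\Bigl|\sum_{b_1,\dots,b_k=0}^1(-1)^{|A\cap B|}\psi_{i_{b_1,1}\ldots i_{b_k,k}}\psi_{i_{1-b_1,1}\ldots i_{1-b_k,k}}\Bigr|^2 .$$ 4. (Dimension.) Consider the complex vector space of $LU$-invariant functions $\mathcal H\to\mathbb C$ that are homogeneous polynomials of degree $4$ in the coefficients $\psi_{i_1\ldots i_k}$ and their complex conjugates. The functions $I_A$, for the even-size $A$ with $V_A\ne0$, form a basis of it, so its dimension is the number of such $A$. If $n_j\ge2$ for all $j$, the dimension is $2^{k-1}$. -/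

import Mathlib

open scoped TensorProduct

noncomputable section

namespace LUInv

universe u

section General

variable {G : Type*} [Monoid G]

/-- The symmetric square `S²(E)`, realised as the space of symmetric tensors in `E ⊗ E`. -/
def symSq (E : Type*) [AddCommGroup E] [Module ℂ E] : Submodule ℂ (E ⊗[ℂ] E) :=
  LinearMap.eqLocus (TensorProduct.comm ℂ E E).toLinearMap LinearMap.id

/-- The exterior square `Λ²(E)`, realised as the space of antisymmetric tensors in `E ⊗ E`. -/
def altSq (E : Type*) [AddCommGroup E] [Module ℂ E] : Submodule ℂ (E ⊗[ℂ] E) :=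
  LinearMap.eqLocus (TensorProduct.comm ℂ E E).toLinearMap (-LinearMap.id)

variable {E : Type*} [AddCommGroup E] [Module ℂ E]

/-- The commutative product `x y = (x ⊗ y + y ⊗ x) / 2` of two vectors, as an element of `S²(E)`;
in particular `x x = x ⊗ x`. -/
def symMul (x y : E) : symSq E :=
  ⟨(1 / 2 : ℂ) • (x ⊗ₜ[ℂ] y + y ⊗ₜ[ℂ] x), by simp [symSq, add_comm]⟩

theorem symMul_self (x : E) : (symMul x x : E ⊗[ℂ] E) = x ⊗ₜ[ℂ] x := by
  simp only [symMul, ← two_smul ℂ (x ⊗ₜ[ℂ] x), smul_smul]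
  norm_num

theorem comm_map (f : E →ₗ[ℂ] E) (t : E ⊗[ℂ] E) :
    TensorProduct.comm ℂ E E (TensorProduct.map f f t) =
      TensorProduct.map f f (TensorProduct.comm ℂ E E t) := by
  induction t with
  | zero => simp
  | tmul x y => simp
  | add x y hx hy => simp only [map_add, hx, hy]

/-- `S²(E)` as a subrepresentation of `E ⊗ E`. -/
def symSub (ρ : Representation ℂ G E) : Subrepresentation (ρ.tprod ρ) where
  toSubmodule := symSq E
  apply_mem_toSubmodule g v hv := by
    have hv' : TensorProduct.comm ℂ E E v = v := hv
    change TensorProduct.comm ℂ E E (TensorProduct.map (ρ g) (ρ g) v) =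
      TensorProduct.map (ρ g) (ρ g) v
    rw [comm_map, hv']

/-- `Λ²(E)` as a subrepresentation of `E ⊗ E`. -/
def altSub (ρ : Representation ℂ G E) : Subrepresentation (ρ.tprod ρ) where
  toSubmodule := altSq E
  apply_mem_toSubmodule g v hv := by
    have hv' : TensorProduct.comm ℂ E E v = -v := hv
    change TensorProduct.comm ℂ E E (TensorProduct.map (ρ g) (ρ g) v) =
      -TensorProduct.map (ρ g) (ρ g) v
    rw [comm_map, hv', map_neg]

/-- The tensor product of a finite family of representations of the same group. -/
def piRep {ι : Type*} {F : ι → Type*} [∀ i, AddCommGroup (F i)] [∀ i, Module ℂ (F i)]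
    (ρ : ∀ i, Representation ℂ G (F i)) : Representation ℂ G (⨂[ℂ] i, F i) where
  toFun g := PiTensorProduct.map fun i => ρ i g
  map_one' := by
    simp only [map_one]
    exact PiTensorProduct.map_one
  map_mul' g h := by
    simp only [map_mul]
    exact PiTensorProduct.map_mul _ _

end General

section Multipartite

variable {k : ℕ} (H : Fin k → Type u) [∀ j, NormedAddCommGroup (H j)]
  [∀ j, InnerProductSpace ℂ (H j)]

/-- The state space `H₁ ⊗ ⋯ ⊗ H_k` of the composite system (a type synonym, which carries
the Hilbert space structure below). -/
def StateSpace : Type u := ⨂[ℂ] j, H j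

/-- The group of local unitary transformations `U(H₁) × ⋯ × U(H_k)`. -/
abbrev LU : Type u := ∀ j, H j ≃ₗᵢ[ℂ] H j

/-- The `j`-th factor acting on `H_j` in the standard way. -/
def stdRep (j : Fin k) : Representation ℂ (LU H) (H j) where
  toFun g := (g j).toLinearEquiv.toLinearMap
  map_one' := rfl
  map_mul' _ _ := rfl

/-- `S²(H_j)` if `j ∉ A`, and `Λ²(H_j)` if `j ∈ A`. -/
def factor (A : Finset (Fin k)) (j : Fin k) :
    Subrepresentation ((stdRep H j).tprod (stdRep H j)) :=
  if j ∈ A then altSub (stdRep H j) else symSub (stdRep H j)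

/-- The representation `⨂_{j ∉ A} S²(H_j) ⊗ ⨂_{j ∈ A} Λ²(H_j)` of the local unitary group. -/
def factorRep (A : Finset (Fin k)) :
    Representation ℂ (LU H) (⨂[ℂ] j, (factor H A j).toSubmodule) :=
  piRep fun j => (factor H A j).toRepresentation

/-- The inclusion of `⨂_{j ∉ A} S²(H_j) ⊗ ⨂_{j ∈ A} Λ²(H_j)` in `⨂ (H_j ⊗ H_j)`. -/
def factorIncl (A : Finset (Fin k)) :
    (⨂[ℂ] j, (factor H A j).toSubmodule) →ₗ[ℂ] ⨂[ℂ] j, (H j ⊗[ℂ] H j) :=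
  PiTensorProduct.mapIncl fun j => (factor H A j).toSubmodule

variable [∀ j, FiniteDimensional ℂ (H j)]

/-- Coordinates with respect to products of orthonormal basis vectors. -/
def coordEquiv : (⨂[ℂ] j, H j) ≃ₗ[ℂ]
    EuclideanSpace ℂ (∀ j, Fin (Module.finrank ℂ (H j))) :=
  (Basis.piTensorProduct fun j => (stdOrthonormalBasis ℂ (H j)).toBasis).equivFun ≪≫ₗ
    (WithLp.linearEquiv 2 ℂ ((∀ j, Fin (Module.finrank ℂ (H j))) → ℂ)).symm

instance : NormedAddCommGroup (StateSpace H) :=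
  NormedAddCommGroup.induced (⨂[ℂ] j, H j) _ (coordEquiv H) (coordEquiv H).injective

/-- The tensor product Hilbert space structure; it is characterised by `inner_prodVec`. -/
instance : InnerProductSpace ℂ (StateSpace H) where
  toModule := inferInstanceAs (Module ℂ (⨂[ℂ] j, H j))
  norm_smul_le c x :=
    (congrArg norm ((coordEquiv H).map_smul c x)).le.trans (norm_smul_le _ _)
  inner x y := inner ℂ (coordEquiv H x) (coordEquiv H y)
  norm_sq_eq_re_inner x := norm_sq_eq_re_inner (𝕜 := ℂ) (coordEquiv H x)
  conj_inner_symm x y := inner_conj_symm _ _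
  add_left x y z := by
    rw [← inner_add_left]
    exact congrArg (inner ℂ · (coordEquiv H z)) ((coordEquiv H).map_add x y)
  smul_left x y c := by
    rw [← inner_smul_left]
    exact congrArg (inner ℂ · (coordEquiv H y)) ((coordEquiv H).map_smul c x)

instance : FiniteDimensional ℂ (StateSpace H) :=
  inferInstanceAs (Module.Finite ℂ (⨂[ℂ] j, H j))

/-- The action of the local unitary group on the state space. -/
def stateRep : Representation ℂ (LU H) (StateSpace H) := piRep (stdRep H)

/-- The natural map `(⨂ H_j) ⊗ (⨂ H_j) → ⨂ (H_j ⊗ H_j)` which regroups the tensor factors,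
`(⨂ x_j) ⊗ (⨂ y_j) ↦ ⨂ (x_j ⊗ y_j)`. -/
def regroup : StateSpace H ⊗[ℂ] StateSpace H →ₗ[ℂ] ⨂[ℂ] j, (H j ⊗[ℂ] H j) :=
  TensorProduct.lift (R := ℂ) (M := StateSpace H) (N := StateSpace H)
    (PiTensorProduct.map₂ fun j => TensorProduct.mk ℂ (H j) (H j))

/-- The symmetric square `S²(H₁ ⊗ ⋯ ⊗ H_k)`, with the inner product of
`(H₁ ⊗ ⋯ ⊗ H_k) ⊗ (H₁ ⊗ ⋯ ⊗ H_k)`. -/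
def SymSq : Type u := symSq (StateSpace H)

instance : NormedAddCommGroup (SymSq H) := inferInstanceAs (NormedAddCommGroup (symSq _))

instance : InnerProductSpace ℂ (SymSq H) := inferInstanceAs (InnerProductSpace ℂ (symSq _))

instance : FiniteDimensional ℂ (SymSq H) := inferInstanceAs (FiniteDimensional ℂ (symSq _))

/-- The inclusion of the symmetric square in the tensor square. -/
def symIncl : SymSq H →ₗ[ℂ] StateSpace H ⊗[ℂ] StateSpace H := (symSq (StateSpace H)).subtype

/-- The action of the local unitary group on `S²(H₁ ⊗ ⋯ ⊗ H_k)`. -/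
def symRep : Representation ℂ (LU H) (SymSq H) := (symSub (stateRep H)).toRepresentation

theorem regroup_apply (g : LU H) (t : StateSpace H ⊗[ℂ] StateSpace H) :
    regroup H (TensorProduct.map (stateRep H g) (stateRep H g) t) =
      piRep (fun j => (stdRep H j).tprod (stdRep H j)) g (regroup H t) := by
  suffices h : regroup H ∘ₗ TensorProduct.map (stateRep H g) (stateRep H g) =
      piRep (fun j => (stdRep H j).tprod (stdRep H j)) g ∘ₗ regroup H from
    LinearMap.congr_fun h t
  apply TensorProduct.ext
  apply PiTensorProduct.ext
  apply MultilinearMap.ext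
  intro x
  apply PiTensorProduct.ext
  apply MultilinearMap.ext
  intro y
  change PiTensorProduct.map₂ _ (PiTensorProduct.map _ (PiTensorProduct.tprod ℂ x))
    (PiTensorProduct.map _ (PiTensorProduct.tprod ℂ y)) =
    PiTensorProduct.map _ (PiTensorProduct.map₂ _ (PiTensorProduct.tprod ℂ x)
      (PiTensorProduct.tprod ℂ y))
  simp only [PiTensorProduct.map_tprod, PiTensorProduct.map₂_tprod_tprod, TensorProduct.mk_apply,
    Representation.tprod_apply, TensorProduct.map_tmul]

/-- The subspace `V_A` of `S²(H₁ ⊗ ⋯ ⊗ H_k)`: the symmetric tensors which, after regrouping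
the tensor factors, lie in `⨂_{j ∉ A} S²(H_j) ⊗ ⨂_{j ∈ A} Λ²(H_j)`. -/
def V (A : Finset (Fin k)) : Subrepresentation (symRep H) where
  toSubmodule := (LinearMap.range (factorIncl H A)).comap (regroup H ∘ₗ symIncl H)
  apply_mem_toSubmodule g v hv := by
    obtain ⟨s, hs⟩ := hv
    refine ⟨factorRep H A g s, ?_⟩
    change _ = regroup H (TensorProduct.map (stateRep H g) (stateRep H g) (symIncl H v))
    rw [regroup_apply]
    change _ = piRep _ g ((regroup H ∘ₗ symIncl H) v)
    rw [← hs]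
    change (PiTensorProduct.map _ ∘ₗ PiTensorProduct.map _) s =
      (PiTensorProduct.map _ ∘ₗ PiTensorProduct.map _) s
    rw [← PiTensorProduct.map_comp, ← PiTensorProduct.map_comp]
    rfl

variable {H}

/-- The product vector `x₁ ⊗ ⋯ ⊗ x_k`. -/
def prodVec (x : ∀ j, H j) : StateSpace H := PiTensorProduct.tprod ℂ x

theorem inner_prodVec (x y : ∀ j, H j) :
    inner ℂ (prodVec x) (prodVec y) = ∏ j, inner ℂ (x j) (y j) := by
  have h : ∀ (z : ∀ j, H j) I, coordEquiv H (prodVec z) I =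
      ∏ j, inner ℂ (stdOrthonormalBasis ℂ (H j) (I j)) (z j) := by
    intro z I
    change (Basis.piTensorProduct fun j => (stdOrthonormalBasis ℂ (H j)).toBasis).repr
      (PiTensorProduct.tprod ℂ z) I = _
    simp [OrthonormalBasis.repr_apply_apply]
  change inner ℂ (coordEquiv H (prodVec x)) (coordEquiv H (prodVec y)) = _
  simp only [PiLp.inner_apply, h, RCLike.inner_apply, map_prod, ← Finset.prod_mul_distrib,
    inner_conj_symm]
  rw [← Fintype.prod_sum fun j (i : Fin (Module.finrank ℂ (H j))) =>
    inner ℂ (stdOrthonormalBasis ℂ (H j) i) (y j) * inner ℂ (x j) (stdOrthonormalBasis ℂ (H j) i)]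
  refine Finset.prod_congr rfl fun j _ => ?_
  rw [← (stdOrthonormalBasis ℂ (H j)).sum_inner_mul_inner (x j) (y j)]
  exact Finset.sum_congr rfl fun i _ => mul_comm _ _

/-- The product `φ ψ = (φ ⊗ ψ + ψ ⊗ φ) / 2` in the symmetric algebra of two vectors of the
state space. -/
def sqMul (φ ψ : StateSpace H) : SymSq H := symMul φ ψ

theorem inner_def (s t : SymSq H) : inner ℂ s t = inner ℂ (symIncl H s) (symIncl H t) := rfl

/-- The inner product on `S²` is normalised so that `‖ψ²‖ = ‖ψ‖²`. -/
theorem norm_sqMul_self (ψ : StateSpace H) : ‖sqMul ψ ψ‖ = ‖ψ‖ ^ 2 := by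
  change ‖(symMul ψ ψ : StateSpace H ⊗[ℂ] StateSpace H)‖ = _
  rw [symMul_self, TensorProduct.norm_tmul, sq]

/-- The invariant `⟨ψ², P_A ψ²⟩`, where `P_A` is the orthogonal projection of `S²(H₁ ⊗ ⋯ ⊗ H_k)`
onto `V_A`. -/
def invariant (A : Finset (Fin k)) (ψ : StateSpace H) : ℂ :=
  inner ℂ (sqMul ψ ψ) ((V H A).toSubmodule.starProjection (sqMul ψ ψ))

variable {n : Fin k → ℕ} (e : ∀ j, OrthonormalBasis (Fin (n j)) ℂ (H j))

/-- The computational basis vector `e_{i₁ ⋯ i_k} = e_{1,i₁} ⊗ ⋯ ⊗ e_{k,i_k}`. -/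
def compBasis (i : ∀ j, Fin (n j)) : StateSpace H := prodVec fun j => e j (i j)

/-- The coefficient `ψ_{i₁ ⋯ i_k}` of `ψ` in the computational basis. -/
def coeff (ψ : StateSpace H) (i : ∀ j, Fin (n j)) : ℂ := inner ℂ (compBasis e i) ψ

/-- The space of LU-invariant functions on `H₁ ⊗ ⋯ ⊗ H_k` which are homogeneous polynomials of
degree `p` in the coefficients (`Sum.inl` variables) and their complex conjugates
(`Sum.inr` variables). -/
def invariantPolys (p : ℕ) : Submodule ℂ (StateSpace H → ℂ) where
  carrier := {f |
    (∃ P : MvPolynomial ((∀ j, Fin (n j)) ⊕ (∀ j, Fin (n j))) ℂ, P.IsHomogeneous p ∧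
      ∀ ψ, f ψ = MvPolynomial.eval
        (Sum.elim (coeff e ψ) fun i => (starRingEnd ℂ) (coeff e ψ i)) P) ∧
    ∀ (g : LU H) (ψ : StateSpace H), f (stateRep H g ψ) = f ψ}
  zero_mem' := ⟨⟨0, MvPolynomial.isHomogeneous_zero _ _ _, by simp⟩, by simp⟩
  add_mem' := by
    rintro f₁ f₂ ⟨⟨P₁, h₁, hf₁⟩, hg₁⟩ ⟨⟨P₂, h₂, hf₂⟩, hg₂⟩
    exact ⟨⟨P₁ + P₂, h₁.add h₂, fun ψ => by simp [hf₁, hf₂]⟩, fun g ψ => by simp [hg₁, hg₂]⟩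
  smul_mem' := by
    rintro c f ⟨⟨P, h, hf⟩, hg⟩
    refine ⟨⟨MvPolynomial.C c * P, ?_, fun ψ => by simp [hf]⟩, fun g ψ => by simp [hg]⟩
    simpa using (MvPolynomial.isHomogeneous_C _ c).mul h

end Multipartite

section Indices

variable {k : ℕ} {n : Fin k → ℕ}

/-- Given two multi-indices `i₀ = p.1`, `i₁ = p.2` and bits `b`, the multi-index `j ↦ i_{b_j, j}`. -/
def pick (p : (∀ j, Fin (n j)) × (∀ j, Fin (n j))) (b : Fin k → Bool) : ∀ j, Fin (n j) :=
  fun j => if b j then p.2 j else p.1 j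

/-- The complementary bits `1 - b`. -/
def flipBits (b : Fin k → Bool) : Fin k → Bool := fun j => !b j

/-- The sign `(-1)^{|A ∩ B|}`, where `B = {j | b_j = 1}`. -/
def bitSign (A : Finset (Fin k)) (b : Fin k → Bool) : ℂ :=
  (-1) ^ (A ∩ Finset.univ.filter fun j => b j = true).card

/-- The number `c` of positions at which `i₀` and `i₁` agree. -/
def agree (p : (∀ j, Fin (n j)) × (∀ j, Fin (n j))) : ℕ :=
  (Finset.univ.filter fun j => p.1 j = p.2 j).card

/-- The index pairs `i₀ ≤ i₁` (entrywise) with `i_{0,j} ≠ i_{1,j}` whenever `j ∈ A`. -/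
def Admissible (n : Fin k → ℕ) (A : Finset (Fin k)) : Type :=
  {p : (∀ j, Fin (n j)) × (∀ j, Fin (n j)) //
    ∀ j, p.1 j ≤ p.2 j ∧ (j ∈ A → p.1 j ≠ p.2 j)}

variable {H : Fin k → Type u} [∀ j, NormedAddCommGroup (H j)]
  [∀ j, InnerProductSpace ℂ (H j)] [∀ j, FiniteDimensional ℂ (H j)]

/-- The vector `∑_b (-1)^{|A ∩ B|} e_{i_{b₁,1} ⋯ i_{b_k,k}} e_{i_{1-b₁,1} ⋯ i_{1-b_k,k}}`
of `S²(H₁ ⊗ ⋯ ⊗ H_k)`. -/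
def basisVec (e : ∀ j, OrthonormalBasis (Fin (n j)) ℂ (H j)) (A : Finset (Fin k))
    (p : (∀ j, Fin (n j)) × (∀ j, Fin (n j))) : SymSq H :=
  ∑ b : Fin k → Bool,
    bitSign A b • sqMul (compBasis e (pick p b)) (compBasis e (pick p (flipBits b)))

/-- The right-hand side of the explicit formula for the invariant of `A`, in terms of the
coefficients of `ψ`. -/
def invariantFormula (e : ∀ j, OrthonormalBasis (Fin (n j)) ℂ (H j)) (A : Finset (Fin k))
    (ψ : StateSpace H) : ℝ :=
  ((2 : ℝ) ^ k)⁻¹ * ∑ p : (∀ j, Fin (n j)) × (∀ j, Fin (n j)) with ∀ j, p.1 j ≤ p.2 j,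
    ((2 : ℝ) ^ agree p)⁻¹ * ‖∑ b : Fin k → Bool,
      bitSign A b * coeff e ψ (pick p b) * coeff e ψ (pick p (flipBits b))‖ ^ 2

end Indices

end LUInv

end

/-!
The whole structure of `S²(H₁ ⊗ ⋯ ⊗ H_k)` follows from one fact, `rankOne_mem_span_symRep`: for `x`,
`y` in the same component `V_A`, the operator `|x⟩⟨y|` is a linear combination of local unitary
operators. For a single Hilbert space `E` it says that an operator on `E ⊗ E` which commutes with
the swap lies in the span of the operators `g ⊗ g` with `g` unitary (`mem_unitarySquares_of_comm`).
To see this, expand `g ⊗ g` for `g = 1 + (z - 1) |x⟩⟨x|` and two values of `z`: this gives `L(X) = X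
⊗ 1 + 1 ⊗ X` for `X = |x⟩⟨x|`, hence for all `X` by polarization. The span is an algebra, and `X ⊗ Y
+ Y ⊗ X = L(X) L(Y) - L(X Y)`. Multilinearity passes to several factors, and the isometry `symPair`
to the symmetric square.

Given this fact, a subrepresentation which is not orthogonal to `V_A` contains it, and an
intertwining map `V_A → S²(H₁ ⊗ ⋯ ⊗ H_k)` is a multiple of the inclusion. Since the `V_A` are
mutually orthogonal and span, they are the irreducible subrepresentations, each has multiplicity
one, and every operator which commutes with the local unitary group is a combination of the
projections `P_A` (`mem_span_proj_of_commute`).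

After regrouping, `basisVec e A p` is the product over `j` of the vectors `e_a ⊗ e_b ± e_b ⊗ e_a`
(`symPair_basisVec`), so its inner products are computed factor by factor. For `|A|` odd the vector
vanishes, and Fourier inversion over all `A` shows that the components span.

A polynomial of degree four which is invariant under the global phases has bidegree `(2, 2)` in the
coordinates and their conjugates, and so it has the form `ψ ↦ ⟨ψ², T ψ²⟩` (`exists_quartic_eq`). By
polarization `T` is unique (`quartic_injective`); hence it commutes with the local unitary group if
the polynomial is invariant, and is then a combination of the `P_A`.
-/

noncomputable section

namespace LUInv

open InnerProductSpace TensorProduct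

universe u

/-! ### Symmetric operators on a tensor square -/

theorem _root_.Representation.mul_mem_span_range {G M : Type*} [Monoid G] [AddCommGroup M]
    [Module ℂ M] (ρ : Representation ℂ G M) {S T : M →ₗ[ℂ] M}
    (hS : S ∈ Submodule.span ℂ (Set.range ρ))
    (hT : T ∈ Submodule.span ℂ (Set.range ρ)) : S * T ∈ Submodule.span ℂ (Set.range ρ) := by
  have h : S * T ∈ Submodule.span ℂ (Set.range ρ) * Submodule.span ℂ (Set.range ρ) :=
    Submodule.mul_mem_mul hS hT
  rw [Submodule.span_mul_span] at h
  refine Submodule.span_mono ?_ h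
  rintro _ ⟨_, ⟨g, rfl⟩, _, ⟨g', rfl⟩, rfl⟩
  exact ⟨g * g', map_mul ρ g g'⟩

section TensorSquare

variable {E : Type*} [NormedAddCommGroup E] [InnerProductSpace ℂ E]

/-- The standard representation of the unitary group of `E`. -/
def unitaryRep (E : Type*) [NormedAddCommGroup E] [InnerProductSpace ℂ E] :
    Representation ℂ (E ≃ₗᵢ[ℂ] E) E where
  toFun g := g.toLinearEquiv.toLinearMap
  map_one' := rfl
  map_mul' _ _ := rfl

/-- The operator `X ⊗ 1 + 1 ⊗ X` on `E ⊗ E`. -/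
def leibniz (X : E →ₗ[ℂ] E) : E ⊗[ℂ] E →ₗ[ℂ] E ⊗[ℂ] E :=
  TensorProduct.map X 1 + TensorProduct.map 1 X

/-- The linear span of the operators `g ⊗ g`, with `g` unitary. -/
abbrev unitarySquares (E : Type*) [NormedAddCommGroup E] [InnerProductSpace ℂ E] :
    Submodule ℂ (E ⊗[ℂ] E →ₗ[ℂ] E ⊗[ℂ] E) :=
  Submodule.span ℂ (Set.range ((unitaryRep E).tprod (unitaryRep E)))

theorem leibniz_add (X Y : E →ₗ[ℂ] E) : leibniz (X + Y) = leibniz X + leibniz Y := by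
  simp only [leibniz, TensorProduct.map_add_left, TensorProduct.map_add_right]
  abel

theorem leibniz_smul (c : ℂ) (X : E →ₗ[ℂ] E) : leibniz (c • X) = c • leibniz X := by
  simp only [leibniz, TensorProduct.map_smul_left, TensorProduct.map_smul_right, smul_add]

variable [FiniteDimensional ℂ E]

/-- `1 + (z - 1) |x⟩⟨x|` is unitary if `|z| = 1` and `‖x‖ = 1`. -/
theorem exists_unitary_phase {x : E} (hx : ‖x‖ = 1) {z : ℂ} (hz : starRingEnd ℂ z * z = 1) :
    ∃ g : E ≃ₗᵢ[ℂ] E, unitaryRep E g = 1 + (z - 1) • (rankOne ℂ x x : E →L[ℂ] E).toLinearMap := by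
  have hxx : inner ℂ x x = 1 := by rw [inner_self_eq_norm_sq_to_K, hx]; simp
  let f : E →ₗ[ℂ] E := 1 + (z - 1) • (rankOne ℂ x x : E →L[ℂ] E).toLinearMap
  have hf : ∀ a b, inner ℂ (f a) (f b) = inner ℂ a b := by
    intro a b
    simp only [f, LinearMap.add_apply, Module.End.one_apply, LinearMap.smul_apply,
      ContinuousLinearMap.coe_coe, rankOne_apply, inner_add_left, inner_add_right, inner_smul_left,
      inner_smul_right, hxx, inner_conj_symm, map_sub, map_one]
    linear_combination inner ℂ a x * inner ℂ x b * hz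
  refine ⟨(f.isometryOfInner hf).toLinearIsometryEquiv rfl, ?_⟩
  ext y
  rfl

/-- With `P = |x⟩⟨x|` and `g = 1 + c P`, `g ⊗ g = 1 + c (P ⊗ 1 + 1 ⊗ P) + c² (P ⊗ P)`. The unitary
operators with `c = -2` and `c = i - 1`, together with the identity, allow `P ⊗ P` to be
eliminated. -/
theorem leibniz_rankOne_self_mem_of_norm_eq_one {x : E} (hx : ‖x‖ = 1) :
    leibniz (rankOne ℂ x x : E →L[ℂ] E).toLinearMap ∈ unitarySquares E := by
  obtain ⟨g, hg⟩ := exists_unitary_phase hx (z := -1) (by simp)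
  obtain ⟨g', hg'⟩ := exists_unitary_phase hx (z := Complex.I) (by simp)
  have h1 : ((unitaryRep E).tprod (unitaryRep E)) 1 ∈ unitarySquares E :=
    Submodule.subset_span ⟨_, rfl⟩
  have h2 : ((unitaryRep E).tprod (unitaryRep E)) g ∈ unitarySquares E :=
    Submodule.subset_span ⟨_, rfl⟩
  have h3 : ((unitaryRep E).tprod (unitaryRep E)) g' ∈ unitarySquares E :=
    Submodule.subset_span ⟨_, rfl⟩
  have e : ∀ g, ((unitaryRep E).tprod (unitaryRep E)) g =
      TensorProduct.map (unitaryRep E g) (unitaryRep E g) := fun _ => rfl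
  rw [map_one] at h1
  rw [e, hg] at h2
  rw [e, hg'] at h3
  generalize (rankOne ℂ x x : E →L[ℂ] E).toLinearMap = P at h2 h3
  have k : ∀ c : ℂ, TensorProduct.map (1 + c • P) (1 + c • P) =
      1 + c • leibniz P + (c * c) • TensorProduct.map P P := by
    intro c
    simp only [leibniz, TensorProduct.map_add_left, TensorProduct.map_add_right,
      TensorProduct.map_smul_left, TensorProduct.map_smul_right, TensorProduct.map_one]
    module
  rw [k] at h2 h3
  have h : leibniz P = (1 / 2 : ℂ) • ((2 + Complex.I) • 1 -
      Complex.I • (1 + (-1 - 1 : ℂ) • leibniz P + ((-1 - 1) * (-1 - 1) : ℂ) • TensorProduct.map P P)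
      - (2 : ℂ) • (1 + (Complex.I - 1) • leibniz P +
        ((Complex.I - 1) * (Complex.I - 1)) • TensorProduct.map P P)) := by
    match_scalars
    · ring
    · ring
    · linear_combination Complex.I_sq
  rw [h]
  exact Submodule.smul_mem _ _ (Submodule.sub_mem _ (Submodule.sub_mem _
    (Submodule.smul_mem _ _ h1) (Submodule.smul_mem _ _ h2)) (Submodule.smul_mem _ _ h3))

theorem leibniz_rankOne_self_mem (x : E) :
    leibniz (rankOne ℂ x x : E →L[ℂ] E).toLinearMap ∈ unitarySquares E := by
  rcases eq_or_ne x 0 with rfl | hx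
  · simp [leibniz]
  have h := leibniz_rankOne_self_mem_of_norm_eq_one (x := (‖x‖⁻¹ : ℂ) • x)
    (by simp [norm_smul, hx])
  have hx' : (‖x‖ : ℂ) ≠ 0 := by simpa using hx
  have e : (rankOne ℂ x x : E →L[ℂ] E).toLinearMap = (‖x‖ ^ 2 : ℂ) •
      (rankOne ℂ ((‖x‖⁻¹ : ℂ) • x) ((‖x‖⁻¹ : ℂ) • x) : E →L[ℂ] E).toLinearMap := by
    ext y
    simp only [ContinuousLinearMap.coe_coe, rankOne_apply, LinearMap.smul_apply, inner_smul_left,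
      smul_smul, map_inv₀, Complex.conj_ofReal]
    congr 1
    field_simp
  rw [e, leibniz_smul]
  exact Submodule.smul_mem _ _ h

/-- Polarization extends `leibniz_rankOne_self_mem` to all operators of rank one, and these
span the space of all operators. -/
theorem leibniz_mem (X : E →ₗ[ℂ] E) : leibniz X ∈ unitarySquares E := by
  have h : ∀ x y : E, leibniz (rankOne ℂ x y : E →L[ℂ] E).toLinearMap ∈ unitarySquares E := by
    intro x y
    have e : (rankOne ℂ x y : E →L[ℂ] E).toLinearMap = (1 / 4 : ℂ) • (
        (rankOne ℂ (x + y) (x + y) : E →L[ℂ] E).toLinearMap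
        + (-1 : ℂ) • (rankOne ℂ (x - y) (x - y) : E →L[ℂ] E).toLinearMap
        + Complex.I •
          (rankOne ℂ (x + Complex.I • y) (x + Complex.I • y) : E →L[ℂ] E).toLinearMap
        + (-Complex.I) •
          (rankOne ℂ (x - Complex.I • y) (x - Complex.I • y) : E →L[ℂ] E).toLinearMap) := by
      ext z
      simp only [ContinuousLinearMap.coe_coe, rankOne_apply, LinearMap.smul_apply,
        LinearMap.add_apply, inner_add_left, inner_sub_left, inner_smul_left, Complex.conj_I]
      match_scalars
      · ring_nf
        simp only [Complex.I_sq]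
        ring
      · ring_nf
        simp only [Complex.I_sq]
        ring
    rw [e]
    simp only [leibniz_add, leibniz_smul]
    have m : ∀ z : E, _ := leibniz_rankOne_self_mem
    exact Submodule.smul_mem _ _ (Submodule.add_mem _ (Submodule.add_mem _ (Submodule.add_mem _
      (m _) (Submodule.smul_mem _ _ (m _))) (Submodule.smul_mem _ _ (m _)))
      (Submodule.smul_mem _ _ (m _)))
  -- `X = ∑ |X b_i⟩⟨b_i|`
  let b := stdOrthonormalBasis ℂ E
  have e : X = ∑ i, (rankOne ℂ (X (b i)) (b i) : E →L[ℂ] E).toLinearMap := by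
    ext z
    conv_lhs => rw [← b.sum_repr' z]
    simp
  have hsum : leibniz X = ∑ i, leibniz (rankOne ℂ (X (b i)) (b i) : E →L[ℂ] E).toLinearMap := by
    conv_lhs => rw [e]
    exact map_sum (AddMonoidHom.mk' leibniz leibniz_add) _ _
  rw [hsum]
  exact Submodule.sum_mem _ fun i _ => h _ _

theorem map_add_map_swap_mem (X Y : E →ₗ[ℂ] E) :
    TensorProduct.map X Y + TensorProduct.map Y X ∈ unitarySquares E := by
  have e : TensorProduct.map X Y + TensorProduct.map Y X =
      leibniz X * leibniz Y - leibniz (X * Y) := by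
    simp only [leibniz, add_mul, mul_add, ← TensorProduct.map_mul, one_mul, mul_one]
    abel
  rw [e]
  exact Submodule.sub_mem _
    (Representation.mul_mem_span_range _ (leibniz_mem X) (leibniz_mem Y)) (leibniz_mem _)

/-- An operator on `E ⊗ E` which commutes with the swap of the two factors is a linear combination
of operators `g ⊗ g` with `g` unitary. -/
theorem mem_unitarySquares_of_comm (T : E ⊗[ℂ] E →ₗ[ℂ] E ⊗[ℂ] E)
    (hT : ∀ t, TensorProduct.comm ℂ E E (T t) = T (TensorProduct.comm ℂ E E t)) :
    T ∈ unitarySquares E := by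
  -- every operator on `E ⊗ E` is a sum of operators `X ⊗ Y`, and `T` equals its average under
  -- conjugation by the swap
  let c := (TensorProduct.comm ℂ E E).toLinearMap
  have h : ∀ Z : E ⊗[ℂ] E →ₗ[ℂ] E ⊗[ℂ] E, Z + c ∘ₗ Z ∘ₗ c ∈ unitarySquares E := by
    intro Z
    obtain ⟨t, rfl⟩ := (homTensorHomEquiv ℂ E E E E).surjective Z
    induction t with
    | zero => simp
    | tmul X Y =>
      have e₁ : homTensorHomEquiv ℂ E E E E (X ⊗ₜ Y) = TensorProduct.map X Y := by
        ext x y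
        simp
      have e₂ : c ∘ₗ TensorProduct.map X Y ∘ₗ c = TensorProduct.map Y X := by
        ext x y
        simp [c]
      rw [e₁, e₂]
      exact map_add_map_swap_mem X Y
    | add s t hs ht =>
      convert Submodule.add_mem _ hs ht using 1
      simp only [map_add, LinearMap.add_comp, LinearMap.comp_add]
      abel
  have e : T = (1 / 2 : ℂ) • (T + c ∘ₗ T ∘ₗ c) := by
    ext x y
    simp only [AlgebraTensorModule.curry_apply, LinearMap.restrictScalars_self, curry_apply,
      LinearMap.smul_apply, LinearMap.add_apply, LinearMap.comp_apply, LinearEquiv.coe_coe, hT, c,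
      comm_tmul]
    module
  rw [e]
  exact Submodule.smul_mem _ _ (h T)

end TensorSquare

/-! ### Dyads in the span of a group of local operators -/

section

variable {k : ℕ} {H : Fin k → Type u} [∀ j, NormedAddCommGroup (H j)]
  [∀ j, InnerProductSpace ℂ (H j)] [∀ j, FiniteDimensional ℂ (H j)]

theorem _root_.MultilinearMap.map_mem_span_image {ι : Type*} [Fintype ι] {M : ι → Type*} {N : Type*}
    [∀ i, AddCommMonoid (M i)] [∀ i, Module ℂ (M i)] [AddCommMonoid N] [Module ℂ N]
    (f : MultilinearMap ℂ M N) (s : ∀ i, Set (M i)) {x : ∀ i, M i}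
    (hx : ∀ i, x i ∈ Submodule.span ℂ (s i)) :
    f x ∈ Submodule.span ℂ (f '' Set.univ.pi s) := by
  classical
  -- replace membership in `s i` by membership in its span one coordinate at a time
  suffices h : ∀ (t : Finset ι) (x : ∀ i, M i), (∀ i ∈ t, x i ∈ Submodule.span ℂ (s i)) →
      (∀ i ∉ t, x i ∈ s i) → f x ∈ Submodule.span ℂ (f '' Set.univ.pi s) from
    h Finset.univ x (fun i _ => hx i) (by simp)
  intro t
  induction t using Finset.induction_on with
  | empty => exact fun x _ hx => Submodule.subset_span ⟨x, fun i _ => hx i (by simp), rfl⟩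
  | insert i t hi ih =>
    intro x h₁ h₂
    have h : ∀ y ∈ Submodule.span ℂ (s i),
        f (Function.update x i y) ∈ Submodule.span ℂ (f '' Set.univ.pi s) := by
      intro y hy
      induction hy using Submodule.span_induction with
      | mem y hy =>
        refine ih _ (fun j hj => ?_) (fun j hj => ?_)
        · rw [Function.update_of_ne (by rintro rfl; exact hi hj)]
          exact h₁ j (Finset.mem_insert_of_mem hj)
        · rcases eq_or_ne j i with rfl | hji
          · simpa using hy
          · rw [Function.update_of_ne hji]
            exact h₂ j (by simp [hji, hj])
      | zero => simp
      | add y z _ _ hy hz => simpa using Submodule.add_mem _ hy hz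
      | smul c y _ hy => simpa using Submodule.smul_mem _ c hy
    simpa using h (x i) (h₁ i (by simp))

/-- `inner_smul_left`, for the scalar multiplication of the tensor product; the latter agrees with
that of the inner product space only up to unfolding of instances. -/
theorem inner_tensor_smul_left {E F : Type*} [NormedAddCommGroup E] [InnerProductSpace ℂ E]
    [NormedAddCommGroup F] [InnerProductSpace ℂ F] (c : ℂ) (s t : E ⊗[ℂ] F) :
    inner ℂ (c • s) t = starRingEnd ℂ c * inner ℂ s t := inner_smul_left s t c

/-- See `inner_tensor_smul_left`. -/
theorem inner_tensor_smul_right {E F : Type*} [NormedAddCommGroup E] [InnerProductSpace ℂ E]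
    [NormedAddCommGroup F] [InnerProductSpace ℂ F] (c : ℂ) (s t : E ⊗[ℂ] F) :
    inner ℂ s (c • t) = c * inner ℂ s t := inner_smul_right s t c

theorem prodVec_induction {P : StateSpace H → Prop} (prod : ∀ x : ∀ j, H j, P (prodVec x))
    (smul : ∀ (c : ℂ) x, P x → P (c • x)) (add : ∀ x y, P x → P y → P (x + y)) (x) : P x :=
  PiTensorProduct.induction_on (R := ℂ) (motive := P) x (fun c y => smul c _ (prod y)) add

theorem prodVec_tmul_induction {P : StateSpace H ⊗[ℂ] StateSpace H → Prop}
    (prod : ∀ x y : ∀ j, H j, P (prodVec x ⊗ₜ prodVec y))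
    (smul : ∀ (c : ℂ) t, P t → P (c • t)) (add : ∀ s t, P s → P t → P (s + t)) (t) : P t := by
  induction t with
  | zero => simpa using smul 0 (prodVec 0 ⊗ₜ prodVec 0) (prod _ _)
  | tmul x y =>
    induction x using prodVec_induction with
    | prod x =>
      induction y using prodVec_induction with
      | prod y => exact prod x y
      | smul c y h => simpa [tmul_smul] using smul c _ h
      | add y z hy hz => simpa [tmul_add] using add _ _ hy hz
    | smul c x h => simpa [smul_tmul'] using smul c _ h
    | add x z hx hz => simpa [add_tmul] using add _ _ hx hz
  | add s t hs ht => exact add s t hs ht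

variable (H) in
/-- The regrouped tensor square `⨂ (H_j ⊗ H_j)`, as a Hilbert space. -/
abbrev PairSpace : Type u := StateSpace fun j => H j ⊗[ℂ] H j

theorem regroup_prodVec (x y : ∀ j, H j) :
    regroup H (prodVec x ⊗ₜ prodVec y) =
      prodVec (H := fun j => H j ⊗[ℂ] H j) fun j => x j ⊗ₜ y j := by
  change PiTensorProduct.map₂ _ (PiTensorProduct.tprod ℂ x) (PiTensorProduct.tprod ℂ y) = _
  rw [PiTensorProduct.map₂_tprod_tprod]
  rfl

variable (H) in
/-- `regroup`, as a map into the Hilbert space `PairSpace H`. -/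
def regroupPair : StateSpace H ⊗[ℂ] StateSpace H →ₗ[ℂ] PairSpace H := regroup H

theorem inner_regroup (s t : StateSpace H ⊗[ℂ] StateSpace H) :
    inner ℂ (regroupPair H s) (regroupPair H t) = inner ℂ s t := by
  induction s using prodVec_tmul_induction with
  | smul c s h => rw [map_smul, inner_smul_left, inner_tensor_smul_left, h]
  | add s s' h h' => simp only [map_add, inner_add_left, h, h']
  | prod x y =>
    induction t using prodVec_tmul_induction with
    | smul c t h => rw [map_smul, inner_smul_right, inner_tensor_smul_right, h]
    | add s s' h h' => simp only [map_add, inner_add_right, h, h']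
    | prod x' y' =>
      have e : ∀ a b : ∀ j, H j, regroupPair H (prodVec a ⊗ₜ prodVec b) =
        prodVec (H := fun j => H j ⊗[ℂ] H j) fun j => a j ⊗ₜ b j := regroup_prodVec
      rw [e, e, inner_prodVec, inner_tmul, inner_prodVec, inner_prodVec, ← Finset.prod_mul_distrib]
      simp only [inner_tmul]

variable (H) in
/-- The isometric embedding of `S²(H₁ ⊗ ⋯ ⊗ H_k)` in `⨂ (H_j ⊗ H_j)`. -/
def symPair : SymSq H →ₗᵢ[ℂ] PairSpace H :=
  (regroupPair H ∘ₗ symIncl H).isometryOfInner fun _ _ => inner_regroup _ _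

variable (H) in
/-- The image of `⨂_{j ∉ A} S²(H_j) ⊗ ⨂_{j ∈ A} Λ²(H_j)` in `⨂ (H_j ⊗ H_j)`, as the span of the
product vectors with all factors in `factor H A j`. -/
def factorSpan (A : Finset (Fin k)) : Submodule ℂ (PairSpace H) :=
  Submodule.span ℂ
    ((fun s : ∀ j, H j ⊗[ℂ] H j => prodVec (H := fun j => H j ⊗[ℂ] H j) s) ''
      {s | ∀ j, s j ∈ (factor H A j).toSubmodule})

theorem mem_V_iff {A : Finset (Fin k)} {x : SymSq H} :
    x ∈ (V H A).toSubmodule ↔ symPair H x ∈ factorSpan H A := by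
  have h : LinearMap.range (factorIncl H A) = Submodule.span ℂ
      (PiTensorProduct.tprod ℂ '' {s | ∀ j, s j ∈ (factor H A j).toSubmodule}) := by
    rw [factorIncl, PiTensorProduct.mapIncl, PiTensorProduct.map_range_eq_span_tprod]
    congr 1
    ext t
    constructor
    · rintro ⟨s, rfl⟩
      exact ⟨_, fun j => (s j).2, rfl⟩
    · rintro ⟨s, hs, rfl⟩
      exact ⟨fun j => ⟨s j, hs j⟩, rfl⟩
  change _ ∈ LinearMap.range (factorIncl H A) ↔ _
  rw [h]
  rfl

/-- On each tensor factor, the dyad of two elements which are both symmetric or both antisymmetric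
commutes with the swap. -/
theorem rankOne_mem_unitarySquares {A : Finset (Fin k)} {j : Fin k} {s t : H j ⊗[ℂ] H j}
    (hs : s ∈ (factor H A j).toSubmodule) (ht : t ∈ (factor H A j).toSubmodule) :
    (rankOne ℂ s t : (H j ⊗[ℂ] H j) →L[ℂ] (H j ⊗[ℂ] H j)).toLinearMap ∈ unitarySquares (H j) := by
  apply mem_unitarySquares_of_comm
  intro z
  -- the swap is unitary and an involution, hence self-adjoint
  have h1 : inner ℂ t (TensorProduct.comm ℂ _ _ z) = inner ℂ (TensorProduct.comm ℂ _ _ t) z := by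
    rw [← inner_comm_comm, TensorProduct.comm_comm]
  unfold factor at hs ht
  split_ifs at hs ht
  · have hs' : TensorProduct.comm ℂ _ _ s = -s := hs
    have ht' : TensorProduct.comm ℂ _ _ t = -t := ht
    simp [h1, hs', ht']
  · have hs' : TensorProduct.comm ℂ _ _ s = s := hs
    have ht' : TensorProduct.comm ℂ _ _ t = t := ht
    simp [h1, hs', ht']

variable (H) in
/-- The action of the local unitary group on `⨂ (H_j ⊗ H_j)`. -/
def pairRep : Representation ℂ (LU H) (PairSpace H) :=
  piRep fun j => (stdRep H j).tprod (stdRep H j)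

theorem symPair_symRep (g : LU H) (x : SymSq H) :
    symPair H (symRep H g x) = pairRep H g (symPair H x) :=
  regroup_apply H g (symIncl H x)

/-- The tensor product of dyads on the factors is the dyad of the product vectors. -/
theorem rankOne_prodVec_mem {A : Finset (Fin k)} {s t : ∀ j, H j ⊗[ℂ] H j}
    (hs : ∀ j, s j ∈ (factor H A j).toSubmodule) (ht : ∀ j, t j ∈ (factor H A j).toSubmodule) :
    (rankOne ℂ (prodVec (H := fun j => H j ⊗[ℂ] H j) s) (prodVec (H := fun j => H j ⊗[ℂ] H j) t) :
      PairSpace H →L[ℂ] PairSpace H).toLinearMap ∈ Submodule.span ℂ (Set.range (pairRep H)) := by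
  have h := (PiTensorProduct.mapMultilinear ℂ (fun j => H j ⊗[ℂ] H j)
    (fun j => H j ⊗[ℂ] H j)).map_mem_span_image _
      (fun j => rankOne_mem_unitarySquares (hs j) (ht j))
  let F : PairSpace H →ₗ[ℂ] PairSpace H :=
    PiTensorProduct.mapMultilinear ℂ (fun j => H j ⊗[ℂ] H j) (fun j => H j ⊗[ℂ] H j)
      fun j => (rankOne ℂ (s j) (t j) : (H j ⊗[ℂ] H j) →L[ℂ] (H j ⊗[ℂ] H j)).toLinearMap
  have e : F =
      (rankOne ℂ (prodVec (H := fun j => H j ⊗[ℂ] H j) s) (prodVec (H := fun j => H j ⊗[ℂ] H j) t) :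
        PairSpace H →L[ℂ] PairSpace H).toLinearMap := by
    refine LinearMap.ext fun x => ?_
    induction x using prodVec_induction with
    | prod x =>
      rw [ContinuousLinearMap.coe_coe, rankOne_apply, inner_prodVec]
      exact (PiTensorProduct.map_tprod _ _).trans
        (MultilinearMap.map_smul_univ (PiTensorProduct.tprod ℂ) _ s)
    | smul c x h => rw [map_smul, map_smul, h]
    | add x y hx hy => rw [map_add, map_add, hx, hy]
  rw [← e]
  refine Submodule.span_mono ?_ h
  rintro _ ⟨T, hT, rfl⟩
  choose g hg using fun j => hT j trivial
  obtain rfl : (fun j => ((unitaryRep (H j)).tprod (unitaryRep (H j))) (g j)) = T := funext hg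
  exact ⟨g, rfl⟩

/-- All operators `|x⟩⟨y|` with `x`, `y` in the same component are linear combinations
of local unitary operators. This is a strong form of Schur's lemma, from which the structure
of `S²(H₁ ⊗ ⋯ ⊗ H_k)` as a representation is read off. -/
theorem rankOne_mem_span_symRep {A : Finset (Fin k)} {x y : SymSq H}
    (hx : x ∈ (V H A).toSubmodule) (hy : y ∈ (V H A).toSubmodule) :
    (rankOne ℂ x y : SymSq H →L[ℂ] SymSq H).toLinearMap ∈
      Submodule.span ℂ (Set.range (symRep H)) := by
  have h : ∀ u v : PairSpace H, u ∈ factorSpan H A → v ∈ factorSpan H A →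
      (rankOne ℂ u v : PairSpace H →L[ℂ] PairSpace H).toLinearMap ∈
        Submodule.span ℂ (Set.range (pairRep H)) := by
    intro u v hu hv
    induction hu, hv using Submodule.span_induction₂ with
    | mem_mem u v hu hv =>
      obtain ⟨s, hs, rfl⟩ := hu
      obtain ⟨t, ht, rfl⟩ := hv
      exact rankOne_prodVec_mem hs ht
    | zero_left => simp
    | zero_right => simp
    | add_left u u' v _ _ _ h h' => simpa using Submodule.add_mem _ h h'
    | add_right u v v' _ _ _ h h' => simpa using Submodule.add_mem _ h h'
    | smul_left c u v _ _ h => simpa using Submodule.smul_mem _ c h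
    | smul_right c u v _ _ h => simpa using Submodule.smul_mem _ _ h
  -- the coefficients found on `PairSpace H` serve for the symmetric square as well
  have h' := h _ _ (mem_V_iff.1 hx) (mem_V_iff.1 hy)
  rw [Finsupp.mem_span_range_iff_exists_finsupp] at h' ⊢
  obtain ⟨c, hc⟩ := h'
  refine ⟨c, LinearMap.ext fun z => (symPair H).injective ?_⟩
  have hz := LinearMap.congr_fun hc (symPair H z)
  simp only [Finsupp.sum, LinearMap.sum_apply, LinearMap.smul_apply, ContinuousLinearMap.coe_coe,
    rankOne_apply, LinearIsometry.inner_map_map, map_sum, map_smul, symPair_symRep] at hz ⊢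
  exact hz

end

/-! ### The explicit vectors on a single tensor factor -/

section

variable {k : ℕ} {H : Fin k → Type u} [∀ j, NormedAddCommGroup (H j)]
  [∀ j, InnerProductSpace ℂ (H j)]

/-- The eigenvalue of the swap of `H_j ⊗ H_j` on `factor H A j`: `-1` if `j ∈ A`, and `1`
otherwise. -/
def swapSign (A : Finset (Fin k)) (j : Fin k) : ℂ := if j ∈ A then -1 else 1

theorem swapSign_mul_self (A : Finset (Fin k)) (j : Fin k) : swapSign A j * swapSign A j = 1 := by
  unfold swapSign; split_ifs <;> simp

theorem conj_swapSign (A : Finset (Fin k)) (j : Fin k) :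
    starRingEnd ℂ (swapSign A j) = swapSign A j := by
  unfold swapSign; split_ifs <;> simp

theorem mem_factor_iff {A : Finset (Fin k)} {j : Fin k} {t : H j ⊗[ℂ] H j} :
    t ∈ (factor H A j).toSubmodule ↔ TensorProduct.comm ℂ _ _ t = swapSign A j • t := by
  unfold factor swapSign
  split_ifs
  · rw [neg_one_smul]; rfl
  · rw [one_smul]; rfl

variable {n : Fin k → ℕ} (e : ∀ j, OrthonormalBasis (Fin (n j)) ℂ (H j))

/-- The (anti)symmetrized product `e_a ⊗ e_b ± e_b ⊗ e_a` of two basis vectors of `H_j`. -/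
def siteVec (A : Finset (Fin k)) (j : Fin k) (a b : Fin (n j)) : H j ⊗[ℂ] H j :=
  e j a ⊗ₜ e j b + swapSign A j • (e j b ⊗ₜ e j a)

theorem siteVec_mem (A : Finset (Fin k)) (j : Fin k) (a b : Fin (n j)) :
    siteVec e A j a b ∈ (factor H A j).toSubmodule := by
  rw [mem_factor_iff]
  simp only [siteVec, map_add, map_smul, comm_tmul, smul_add, smul_smul, swapSign_mul_self,
    one_smul]
  exact add_comm _ _

theorem factor_eq_span (A : Finset (Fin k)) (j : Fin k) :
    (factor H A j).toSubmodule = Submodule.span ℂ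
      ((fun p : Fin (n j) × Fin (n j) => siteVec e A j p.1 p.2) ''
        {p | p.1 ≤ p.2 ∧ (j ∈ A → p.1 ≠ p.2)}) := by
  apply le_antisymm
  · intro t ht
    rw [mem_factor_iff] at ht
    have hsite : ∀ a b, siteVec e A j a b ∈ Submodule.span ℂ
      ((fun p : Fin (n j) × Fin (n j) => siteVec e A j p.1 p.2) ''
        {p | p.1 ≤ p.2 ∧ (j ∈ A → p.1 ≠ p.2)}) := by
      intro a b
      by_cases hab : j ∈ A ∧ a = b
      · obtain ⟨hj, rfl⟩ := hab
        simp [siteVec, swapSign, hj]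
      rcases le_total a b with h | h
      · exact Submodule.subset_span ⟨(a, b), ⟨h, fun hj hab' => hab ⟨hj, hab'⟩⟩, rfl⟩
      · have h' : siteVec e A j a b = swapSign A j • siteVec e A j b a := by
          simp only [siteVec, smul_add, smul_smul, swapSign_mul_self, one_smul]
          exact add_comm _ _
        rw [h']
        exact Submodule.smul_mem _ _
          (Submodule.subset_span ⟨(b, a), ⟨h, fun hj hab' => hab ⟨hj, hab'.symm⟩⟩, rfl⟩)
    -- `t` is half of `t ± swap t`, which for basis tensors is a vector `siteVec e A j a b`
    have hadd : ∀ t : H j ⊗[ℂ] H j, t + swapSign A j • TensorProduct.comm ℂ _ _ t ∈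
        Submodule.span ℂ ((fun p : Fin (n j) × Fin (n j) => siteVec e A j p.1 p.2) ''
          {p | p.1 ≤ p.2 ∧ (j ∈ A → p.1 ≠ p.2)}) := by
      intro t
      have hb := ((e j).toBasis.tensorProduct (e j).toBasis).mem_span t
      induction hb using Submodule.span_induction with
      | mem t ht =>
        obtain ⟨⟨a, b⟩, rfl⟩ := ht
        simpa [siteVec] using hsite a b
      | zero => simp
      | add s t _ _ hs ht =>
        convert Submodule.add_mem _ hs ht using 1
        simp only [map_add, smul_add]
        abel
      | smul c t _ ht =>
        convert Submodule.smul_mem _ c ht using 1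
        simp only [map_smul, smul_add, smul_comm c]
    have h := Submodule.smul_mem _ (1 / 2 : ℂ) (hadd t)
    rw [ht, smul_smul, swapSign_mul_self, one_smul, ← two_smul ℂ t, smul_smul] at h
    simpa using h
  · rw [Submodule.span_le]
    rintro _ ⟨p, -, rfl⟩
    exact siteVec_mem e A j _ _

theorem inner_siteVec (A B : Finset (Fin k)) (j : Fin k) {a b c d : Fin (n j)} (hab : a ≤ b)
    (hcd : c ≤ d) : inner ℂ (siteVec e A j a b) (siteVec e B j c d) =
      if a = c ∧ b = d then
        (if a = b then (1 + swapSign A j) * (1 + swapSign B j) else 1 + swapSign A j * swapSign B j)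
      else 0 := by
  simp only [siteVec, inner_add_left, inner_add_right, inner_tensor_smul_left,
    inner_tensor_smul_right, inner_tmul, OrthonormalBasis.inner_eq_ite, conj_swapSign]
  split_ifs <;> first | omega | simp <;> ring

variable [∀ j, FiniteDimensional ℂ (H j)]

/-! ### The explicit orthogonal bases -/

theorem bitSign_eq_prod (A : Finset (Fin k)) (b : Fin k → Bool) :
    bitSign A b = ∏ j, if b j then swapSign A j else 1 := by
  have h : ∀ j, (if b j then swapSign A j else 1) =
      if j ∈ A ∩ Finset.univ.filter (fun j => b j = true) then (-1 : ℂ) else 1 := by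
    intro j
    by_cases hb : b j <;> by_cases hj : j ∈ A <;> simp [swapSign, hb, hj]
  simp only [h, bitSign, Finset.prod_ite_mem, Finset.univ_inter, Finset.prod_const]

theorem bitSign_mul_self (A : Finset (Fin k)) (b : Fin k → Bool) :
    bitSign A b * bitSign A b = 1 := by
  rw [bitSign, ← mul_pow]; simp

theorem conj_bitSign (A : Finset (Fin k)) (b : Fin k → Bool) :
    starRingEnd ℂ (bitSign A b) = bitSign A b := by
  simp [bitSign]

theorem bitSign_flipBits (A : Finset (Fin k)) (b : Fin k → Bool) :
    bitSign A (flipBits b) = (-1) ^ A.card * bitSign A b := by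
  have h : bitSign A (flipBits b) * bitSign A b = (-1) ^ A.card := by
    rw [bitSign_eq_prod, bitSign_eq_prod, ← Finset.prod_mul_distrib]
    have h' : ∀ j, ((if flipBits b j then swapSign A j else 1) * if b j then swapSign A j else 1) =
        if j ∈ A then (-1 : ℂ) else 1 := by
      intro j
      by_cases hb : b j <;> simp [flipBits, swapSign, hb]
    simp [h', Finset.prod_ite_mem]
  rw [← h, mul_assoc, bitSign_mul_self, mul_one]

theorem flipBits_flipBits (b : Fin k → Bool) : flipBits (flipBits b) = b := by
  funext j; simp [flipBits]

theorem sum_flipBits {M : Type*} [AddCommMonoid M] (f : (Fin k → Bool) → M) :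
    ∑ b, f (flipBits b) = ∑ b, f b :=
  Equiv.sum_comp (Function.Involutive.toPerm flipBits flipBits_flipBits) f

theorem sqMul_comm (φ ψ : StateSpace H) : sqMul φ ψ = sqMul ψ φ := by
  apply Subtype.ext
  simp only [sqMul, symMul, add_comm]

/-- Flipping all bits exchanges the two factors of each term, and for `|A|` odd it changes
the sign. -/
theorem basisVec_eq_zero_of_odd {A : Finset (Fin k)} (hA : ¬ Even A.card)
    (p : (∀ j, Fin (n j)) × (∀ j, Fin (n j))) : basisVec e A p = 0 := by
  have h : basisVec e A p = -basisVec e A p := by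
    conv_lhs => rw [basisVec, ← sum_flipBits]
    rw [basisVec, ← Finset.sum_neg_distrib]
    refine Finset.sum_congr rfl fun b _ => ?_
    rw [bitSign_flipBits, flipBits_flipBits, sqMul_comm, (Nat.not_even_iff_odd.1 hA).neg_one_pow,
      neg_one_mul, neg_smul]
  have h2 : (2 : ℂ) • basisVec e A p = 0 := by
    rw [two_smul]
    exact eq_neg_iff_add_eq_zero.1 h
  exact (smul_eq_zero.1 h2).resolve_left two_ne_zero

theorem symIncl_sqMul (φ ψ : StateSpace H) :
    symIncl H (sqMul φ ψ) = (1 / 2 : ℂ) • (φ ⊗ₜ[ℂ] ψ + ψ ⊗ₜ[ℂ] φ) := rfl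

/-- For `|A|` even, the two halves of the products in `basisVec` contribute the same sum, since
flipping all bits exchanges them and preserves the signs. -/
theorem symIncl_basisVec {A : Finset (Fin k)} (hA : Even A.card)
    (p : (∀ j, Fin (n j)) × (∀ j, Fin (n j))) : symIncl H (basisVec e A p) =
      ∑ b, bitSign A b • (compBasis e (pick p b) ⊗ₜ[ℂ] compBasis e (pick p (flipBits b))) := by
  have h : ∑ b, bitSign A b • (compBasis e (pick p (flipBits b)) ⊗ₜ[ℂ] compBasis e (pick p b)) =
      ∑ b, bitSign A b • (compBasis e (pick p b) ⊗ₜ[ℂ] compBasis e (pick p (flipBits b))) := by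
    rw [← sum_flipBits]
    simp only [bitSign_flipBits, flipBits_flipBits, hA.neg_one_pow, one_mul]
  have h2 : symIncl H (basisVec e A p) = (1 / 2 : ℂ) •
      (∑ b, bitSign A b • (compBasis e (pick p b) ⊗ₜ[ℂ] compBasis e (pick p (flipBits b))) +
       ∑ b, bitSign A b • (compBasis e (pick p (flipBits b)) ⊗ₜ[ℂ] compBasis e (pick p b))) := by
    simp only [basisVec, map_sum, map_smul, symIncl_sqMul, ← Finset.sum_add_distrib,
      Finset.smul_sum, ← smul_add]
    exact Finset.sum_congr rfl fun b _ => smul_comm _ _ _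
  rw [h2, h, ← two_smul ℂ, smul_smul]
  norm_num

/-- The sum over the bits is the expansion of a product of two-term sums, one for each tensor
factor. -/
theorem symPair_basisVec {A : Finset (Fin k)} (hA : Even A.card)
    (p : (∀ j, Fin (n j)) × (∀ j, Fin (n j))) : symPair H (basisVec e A p) =
      prodVec (H := fun j => H j ⊗[ℂ] H j) fun j => siteVec e A j (p.1 j) (p.2 j) := by
  have h : ∀ j, siteVec e A j (p.1 j) (p.2 j) = ∑ c : Bool, (if c then swapSign A j else 1) •
      (e j (if c then p.2 j else p.1 j) ⊗ₜ[ℂ] e j (if !c then p.2 j else p.1 j)) := by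
    intro j
    simp [siteVec, add_comm]
  have h2 : symPair H (basisVec e A p) = regroupPair H (symIncl H (basisVec e A p)) := rfl
  have h3 : ∀ a b : ∀ j, H j, regroupPair H (prodVec a ⊗ₜ prodVec b) =
        prodVec (H := fun j => H j ⊗[ℂ] H j) fun j => a j ⊗ₜ b j := regroup_prodVec
  rw [h2, symIncl_basisVec e hA, map_sum]
  simp only [map_smul, compBasis, h3, h]
  refine Eq.trans ?_ (MultilinearMap.map_sum (PiTensorProduct.tprod ℂ) fun j (c : Bool) =>
    (if c then swapSign A j else 1) • (e j (if c then p.2 j else p.1 j) ⊗ₜ[ℂ]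
      e j (if !c then p.2 j else p.1 j))).symm
  refine Finset.sum_congr rfl fun b _ => ?_
  rw [bitSign_eq_prod]
  exact (MultilinearMap.map_smul_univ (PiTensorProduct.tprod ℂ) _ _).symm

/-- After regrouping, the vectors `basisVec e A p` span the tensor product of the factors. -/
theorem map_span_basisVec {A : Finset (Fin k)} (hA : Even A.card) :
    (Submodule.span ℂ (Set.range fun p : Admissible n A => basisVec e A p.1)).map
      (symPair H).toLinearMap = factorSpan H A := by
  rw [factorSpan, Submodule.map_span, ← Set.range_comp]
  have h2 : ∀ p : Admissible n A, ((symPair H).toLinearMap ∘ fun p : Admissible n A =>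
      basisVec e A p.1) p = prodVec (H := fun j => H j ⊗[ℂ] H j)
        fun j => siteVec e A j (p.1.1 j) (p.1.2 j) := fun p => symPair_basisVec e hA p.1
  apply le_antisymm
  · rw [Submodule.span_le]
    rintro _ ⟨p, rfl⟩
    refine Set.mem_of_eq_of_mem (h2 p) ?_
    exact Submodule.subset_span ⟨_, fun j => siteVec_mem e A j _ _, rfl⟩
  · rw [Submodule.span_le]
    rintro _ ⟨s, hs, rfl⟩
    simp only [Set.mem_ofPred_eq, factor_eq_span e] at hs
    have h3 := (PiTensorProduct.tprod ℂ (s := fun j => H j ⊗[ℂ] H j)).map_mem_span_image _ hs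
    refine Submodule.span_mono ?_ h3
    rintro _ ⟨t, ht, rfl⟩
    choose q hq hqt using fun j => ht j trivial
    refine ⟨⟨(fun j => (q j).1, fun j => (q j).2), hq⟩, ?_⟩
    refine (h2 _).trans ?_
    exact congrArg (PiTensorProduct.tprod ℂ) (funext hqt)

theorem V_eq_span {A : Finset (Fin k)} (hA : Even A.card) : (V H A).toSubmodule =
    Submodule.span ℂ (Set.range fun p : Admissible n A => basisVec e A p.1) := by
  ext x
  rw [mem_V_iff, ← map_span_basisVec e hA]
  exact (symPair H).injective.mem_set_image

theorem basisVec_mem {A : Finset (Fin k)} (hA : Even A.card)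
    (p : (∀ j, Fin (n j)) × (∀ j, Fin (n j))) : basisVec e A p ∈ (V H A).toSubmodule := by
  rw [mem_V_iff, symPair_basisVec e hA]
  exact Submodule.subset_span ⟨_, fun j => siteVec_mem e A j _ _, rfl⟩

theorem inner_basisVec {A B : Finset (Fin k)} (hA : Even A.card) (hB : Even B.card)
    {p q : (∀ j, Fin (n j)) × (∀ j, Fin (n j))} (hp : p.1 ≤ p.2) (hq : q.1 ≤ q.2) :
    inner ℂ (basisVec e A p) (basisVec e B q) = ∏ j, if p.1 j = q.1 j ∧ p.2 j = q.2 j then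
        (if p.1 j = p.2 j then (1 + swapSign A j) * (1 + swapSign B j)
          else 1 + swapSign A j * swapSign B j)
      else 0 := by
  rw [← LinearIsometry.inner_map_map (symPair H), symPair_basisVec e hA, symPair_basisVec e hB,
    inner_prodVec]
  exact Finset.prod_congr rfl fun j _ => inner_siteVec e A B j (hp j) (hq j)

theorem inner_basisVec_of_ne {A : Finset (Fin k)} (hA : Even A.card)
    {p q : (∀ j, Fin (n j)) × (∀ j, Fin (n j))} (hp : p.1 ≤ p.2) (hq : q.1 ≤ q.2) (hpq : p ≠ q) :
    inner ℂ (basisVec e A p) (basisVec e A q) = 0 := by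
  rw [inner_basisVec e hA hA hp hq]
  have h : ∃ j, ¬ (p.1 j = q.1 j ∧ p.2 j = q.2 j) := by
    by_contra! h
    exact hpq (Prod.ext (funext fun j => (h j).1) (funext fun j => (h j).2))
  obtain ⟨j, hj⟩ := h
  exact Finset.prod_eq_zero (Finset.mem_univ j) (if_neg hj)

theorem inner_basisVec_of_ne_finset {A B : Finset (Fin k)} (hA : Even A.card) (hB : Even B.card)
    (hAB : A ≠ B) {p q : (∀ j, Fin (n j)) × (∀ j, Fin (n j))} (hp : p.1 ≤ p.2) (hq : q.1 ≤ q.2) :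
    inner ℂ (basisVec e A p) (basisVec e B q) = 0 := by
  rw [inner_basisVec e hA hB hp hq]
  obtain ⟨j, hj⟩ : ∃ j, ¬ (j ∈ A ↔ j ∈ B) := by
    by_contra! h
    exact hAB (Finset.ext h)
  refine Finset.prod_eq_zero (Finset.mem_univ j) ?_
  by_cases h1 : j ∈ A <;> by_cases h2 : j ∈ B <;> simp_all [swapSign]

theorem inner_basisVec_self {A : Finset (Fin k)} (hA : Even A.card)
    {p : (∀ j, Fin (n j)) × (∀ j, Fin (n j))} (hp : p.1 ≤ p.2) (hpA : ∀ j ∈ A, p.1 j ≠ p.2 j) :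
    inner ℂ (basisVec e A p) (basisVec e A p) = (2 : ℂ) ^ (k + agree p) := by
  rw [inner_basisVec e hA hA hp hp]
  have h' : ∀ j, (if p.1 j = p.1 j ∧ p.2 j = p.2 j then
      (if p.1 j = p.2 j then (1 + swapSign A j) * (1 + swapSign A j)
        else 1 + swapSign A j * swapSign A j)
      else 0) = 2 * if p.1 j = p.2 j then (2 : ℂ) else 1 := by
    intro j
    by_cases hj : p.1 j = p.2 j
    · have : j ∉ A := fun hjA => hpA j hjA hj
      simp only [hj, swapSign, this]
      norm_num
    · simp only [hj, swapSign_mul_self]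
      norm_num
  rw [Finset.prod_congr rfl fun j _ => h' j]
  simp only [Finset.prod_mul_distrib, Finset.prod_ite, Finset.prod_const, agree, pow_add]
  simp

theorem norm_sq_basisVec {A : Finset (Fin k)} (hA : Even A.card)
    {p : (∀ j, Fin (n j)) × (∀ j, Fin (n j))} (hp : p.1 ≤ p.2) (hpA : ∀ j ∈ A, p.1 j ≠ p.2 j) :
    ‖basisVec e A p‖ ^ 2 = (2 : ℝ) ^ (k + agree p) := by
  have h := inner_basisVec_self e hA hp hpA
  rw [inner_self_eq_norm_sq_to_K] at h
  exact Complex.ofReal_injective (by simpa using h)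

theorem basisVec_eq_zero {A : Finset (Fin k)} (hA : Even A.card)
    {p : (∀ j, Fin (n j)) × (∀ j, Fin (n j))} (hp : p.1 ≤ p.2) {j : Fin k} (hj : j ∈ A)
    (hpj : p.1 j = p.2 j) : basisVec e A p = 0 := by
  rw [← inner_self_eq_zero (𝕜 := ℂ), inner_basisVec e hA hA hp hp]
  refine Finset.prod_eq_zero (Finset.mem_univ j) ?_
  simp [hpj, swapSign, hj]

end

/-! ### The decomposition of the symmetric square -/

section

variable {k : ℕ} {H : Fin k → Type u} [∀ j, NormedAddCommGroup (H j)]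
  [∀ j, InnerProductSpace ℂ (H j)]

theorem factorIncl_injective (A : Finset (Fin k)) : Function.Injective (factorIncl H A) := by
  choose g hg using fun j => LinearMap.exists_leftInverse_of_injective
    (factor H A j).toSubmodule.subtype (Submodule.ker_subtype _)
  have h : PiTensorProduct.map g ∘ₗ factorIncl H A = LinearMap.id := by
    rw [factorIncl, PiTensorProduct.mapIncl, ← PiTensorProduct.map_comp]
    simp only [hg]
    exact PiTensorProduct.map_id
  exact Function.LeftInverse.injective (LinearMap.congr_fun h)

variable [∀ j, FiniteDimensional ℂ (H j)]

variable (H) in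
/-- The product `sqMul` as a bilinear map. -/
def sqMulBilin : StateSpace H →ₗ[ℂ] StateSpace H →ₗ[ℂ] SymSq H :=
  LinearMap.mk₂ ℂ sqMul
    (fun x y z => Subtype.ext <| by
      change (1 / 2 : ℂ) • _ = (1 / 2 : ℂ) • _ + (1 / 2 : ℂ) • _
      rw [add_tmul, tmul_add]; module)
    (fun c x y => Subtype.ext <| by
      change (1 / 2 : ℂ) • _ = c • (1 / 2 : ℂ) • _
      rw [← smul_tmul', tmul_smul]; module)
    (fun x y z => Subtype.ext <| by
      change (1 / 2 : ℂ) • _ = (1 / 2 : ℂ) • _ + (1 / 2 : ℂ) • _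
      rw [add_tmul, tmul_add]; module)
    (fun c x y => Subtype.ext <| by
      change (1 / 2 : ℂ) • _ = c • (1 / 2 : ℂ) • _
      rw [← smul_tmul', tmul_smul]; module)

theorem sqMulBilin_apply (x y : StateSpace H) : sqMulBilin H x y = sqMul x y := rfl

/-- The linear extension of the product to the tensor square symmetrizes tensors, and so it fixes
the symmetric ones. -/
theorem lift_sqMulBilin_symIncl (t : SymSq H) :
    TensorProduct.lift (sqMulBilin H) (symIncl H t) = t := by
  have h : ∀ s, symIncl H (TensorProduct.lift (sqMulBilin H) s) =
      (1 / 2 : ℂ) • (s + TensorProduct.comm ℂ _ _ s) := by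
    intro s
    induction s with
    | zero => simp
    | tmul x y => rw [lift.tmul, sqMulBilin_apply, symIncl_sqMul, comm_tmul]
    | add s t hs ht => simp only [map_add, hs, ht, smul_add]; abel
  apply Subtype.ext
  have ht : TensorProduct.comm ℂ _ _ (symIncl H t) = symIncl H t := t.2
  have h' := h (symIncl H t)
  rw [ht, ← two_smul ℂ, smul_smul] at h'
  norm_num at h'
  exact h'

variable {n : Fin k → ℕ} (e : ∀ j, OrthonormalBasis (Fin (n j)) ℂ (H j))

theorem span_compBasis : Submodule.span ℂ (Set.range (compBasis e)) = ⊤ := by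
  rw [eq_top_iff]
  rintro x -
  induction x using prodVec_induction with
  | prod x =>
    have h := (PiTensorProduct.tprod ℂ (s := H)).map_mem_span_image (fun j => Set.range (e j))
      (x := x) fun j => by
        have h := (e j).toBasis.mem_span (x j)
        rwa [OrthonormalBasis.coe_toBasis] at h
    refine Submodule.span_mono ?_ h
    rintro _ ⟨t, ht, rfl⟩
    choose i hi using fun j => ht j trivial
    exact ⟨i, congrArg (PiTensorProduct.tprod ℂ) (funext hi)⟩
  | smul c x h => exact Submodule.smul_mem _ c h
  | add x y hx hy => exact Submodule.add_mem _ hx hy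

theorem span_sqMul_compBasis : Submodule.span ℂ (Set.range
    fun i : (∀ j, Fin (n j)) × (∀ j, Fin (n j)) => sqMul (compBasis e i.1) (compBasis e i.2)) =
      ⊤ := by
  rw [eq_top_iff]
  rintro t -
  rw [← lift_sqMulBilin_symIncl t]
  induction symIncl H t with
  | zero => simp
  | tmul x y =>
    rw [lift.tmul]
    have hx : x ∈ Submodule.span ℂ (Set.range (compBasis e)) := by simp [span_compBasis]
    have hy : y ∈ Submodule.span ℂ (Set.range (compBasis e)) := by simp [span_compBasis]
    induction hx, hy using Submodule.span_induction₂ with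
    | mem_mem x y hx hy =>
      obtain ⟨i, rfl⟩ := hx
      obtain ⟨i', rfl⟩ := hy
      exact Submodule.subset_span ⟨(i, i'), rfl⟩
    | zero_left => simp
    | zero_right => simp
    | add_left x x' y _ _ _ h h' => simpa using Submodule.add_mem _ h h'
    | add_right x y y' _ _ _ h h' => simpa using Submodule.add_mem _ h h'
    | smul_left c x y _ _ h => simpa using Submodule.smul_mem _ c h
    | smul_right c x y _ _ h => simpa using Submodule.smul_mem _ c h
  | add s t hs ht => rw [map_add]; exact Submodule.add_mem _ hs ht

theorem sum_bitSign_mul_bitSign (b b' : Fin k → Bool) :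
    ∑ A : Finset (Fin k), bitSign A b * bitSign A b' = if b' = b then 2 ^ k else 0 := by
  have h : ∀ A : Finset (Fin k), bitSign A b * bitSign A b' =
      ∏ j ∈ A, if b' j = b j then (1 : ℂ) else -1 := by
    intro A
    rw [bitSign_eq_prod, bitSign_eq_prod, ← Finset.prod_mul_distrib,
      ← Finset.prod_subset (Finset.subset_univ A)]
    · refine Finset.prod_congr rfl fun j hj => ?_
      cases b j <;> cases b' j <;> simp [swapSign, hj]
    · intro j _ hj
      simp [swapSign, hj]
  rw [Finset.sum_congr rfl fun A _ => h A, ← Finset.powerset_univ, ← Finset.prod_one_add]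
  split_ifs with hb
  · subst hb
    norm_num
  · obtain ⟨j, hj⟩ := Function.ne_iff.1 hb
    exact Finset.prod_eq_zero (Finset.mem_univ j) (by simp [hj])

/-- Fourier inversion over the sets `A` recovers the products of basis vectors. -/
theorem sum_bitSign_smul_basisVec (p : (∀ j, Fin (n j)) × (∀ j, Fin (n j))) (b : Fin k → Bool) :
    ∑ A : Finset (Fin k), bitSign A b • basisVec e A p =
      (2 : ℂ) ^ k • sqMul (compBasis e (pick p b)) (compBasis e (pick p (flipBits b))) := by
  simp only [basisVec, Finset.smul_sum, smul_smul]
  rw [Finset.sum_comm]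
  simp only [← Finset.sum_smul, sum_bitSign_mul_bitSign, ite_smul, zero_smul]
  simp

theorem iSup_V_eq_top : ⨆ A : {A : Finset (Fin k) // Even A.card}, (V H A.1).toSubmodule = ⊤ := by
  -- any orthonormal bases of the factors will do
  let e := fun j => stdOrthonormalBasis ℂ (H j)
  rw [eq_top_iff, ← span_sqMul_compBasis e, Submodule.span_le]
  rintro _ ⟨i, rfl⟩
  -- sort the two multi-indices entrywise, recording the order in bits
  let p : (∀ j, Fin (Module.finrank ℂ (H j))) × (∀ j, Fin (Module.finrank ℂ (H j))) :=
    (fun j => min (i.1 j) (i.2 j), fun j => max (i.1 j) (i.2 j))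
  let b : Fin k → Bool := fun j => decide (i.2 j < i.1 j)
  have h1 : pick p b = i.1 := by
    funext j
    by_cases h : i.2 j < i.1 j
    · simp [pick, p, b, h, h.le]
    · simp [pick, p, b, h, not_lt.1 h]
  have h2 : pick p (flipBits b) = i.2 := by
    funext j
    by_cases h : i.2 j < i.1 j
    · simp [pick, flipBits, p, b, h, h.le]
    · simp [pick, flipBits, p, b, h, not_lt.1 h]
  have h3 := sum_bitSign_smul_basisVec e p b
  rw [h1, h2] at h3
  have h4 : sqMul (compBasis e i.1) (compBasis e i.2) =
      ((2 : ℂ) ^ k)⁻¹ • ∑ A : Finset (Fin k), bitSign A b • basisVec e A p := by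
    rw [h3, smul_smul, inv_mul_cancel₀ (pow_ne_zero k two_ne_zero), one_smul]
  change sqMul (compBasis e i.1) (compBasis e i.2) ∈ _
  rw [h4]
  refine Submodule.smul_mem _ _ (Submodule.sum_mem _ fun A _ => Submodule.smul_mem _ _ ?_)
  by_cases hA : Even A.card
  · exact Submodule.mem_iSup_of_mem (⟨A, hA⟩ : {A : Finset (Fin k) // Even A.card})
      (basisVec_mem e hA p)
  · rw [basisVec_eq_zero_of_odd e hA]
    exact Submodule.zero_mem _

theorem V_isOrtho {A B : Finset (Fin k)} (hA : Even A.card) (hB : Even B.card) (hAB : A ≠ B) :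
    (V H A).toSubmodule ⟂ (V H B).toSubmodule := by
  let e := fun j => stdOrthonormalBasis ℂ (H j)
  rw [V_eq_span e hA, V_eq_span e hB, Submodule.isOrtho_span]
  rintro _ ⟨p, rfl⟩ _ ⟨q, rfl⟩
  exact inner_basisVec_of_ne_finset e hA hB hAB (fun j => (p.2 j).1) (fun j => (q.2 j).1)

theorem isInternal_V [DecidableEq {A : Finset (Fin k) // Even A.card}] : DirectSum.IsInternal
    (fun A : {A : Finset (Fin k) // Even A.card} => (V H A.1).toSubmodule) := by
  have h : OrthogonalFamily ℂ
      (fun A : {A : Finset (Fin k) // Even A.card} => (V H A.1).toSubmodule)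
      fun A => (V H A.1).toSubmodule.subtypeₗᵢ := by
    intro A B hAB x y
    exact (V_isOrtho A.2 B.2 fun h => hAB (Subtype.ext h)).inner_eq x.2 y.2
  rw [h.isInternal_iff, iSup_V_eq_top, Submodule.top_orthogonal_eq_bot]

theorem basisVec_ne_zero {A : Finset (Fin k)} (hA : Even A.card) (p : Admissible n A) :
    basisVec e A p.1 ≠ 0 := by
  intro h
  have h' := norm_sq_basisVec e hA (p := p.1) (fun j => (p.2 j).1) (fun j => (p.2 j).2)
  rw [h, norm_zero] at h'
  have : (0 : ℝ) < 2 ^ (k + agree p.1) := by positivity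
  simp [← h'] at this

theorem inner_basisVec_admissible {A : Finset (Fin k)} (hA : Even A.card) {p q : Admissible n A}
    (hpq : p ≠ q) : inner ℂ (basisVec e A p.1) (basisVec e A q.1) = 0 :=
  inner_basisVec_of_ne e hA (fun j => (p.2 j).1) (fun j => (q.2 j).1)
    fun h => hpq (Subtype.ext h)

theorem linearIndependent_basisVec {A : Finset (Fin k)} (hA : Even A.card) :
    LinearIndependent ℂ (fun p : Admissible n A => basisVec e A p.1) :=
  linearIndependent_of_ne_zero_of_inner_eq_zero (basisVec_ne_zero e hA)
    fun _ _ hpq => inner_basisVec_admissible e hA hpq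

include e in
theorem V_ne_bot_iff {A : Finset (Fin k)} (hA : Even A.card) :
    (V H A).toSubmodule ≠ ⊥ ↔ (∀ j, 1 ≤ n j) ∧ ∀ j ∈ A, 2 ≤ n j := by
  rw [V_eq_span e hA]
  constructor
  · intro h
    obtain ⟨p⟩ : Nonempty (Admissible n A) := by
      by_contra hempty
      rw [not_nonempty_iff] at hempty
      exact h (by rw [Set.range_eq_empty, Submodule.span_empty])
    refine ⟨fun j => (Nat.zero_le _).trans_lt (p.1.1 j).2, fun j hj => ?_⟩
    have h1 := lt_of_le_of_ne (p.2 j).1 ((p.2 j).2 hj)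
    have h2 := (p.1.2 j).2
    rw [Fin.lt_def] at h1
    omega
  · rintro ⟨h1, h2⟩ h
    let p : Admissible n A := ⟨(fun j => ⟨0, h1 j⟩, fun j => if hj : j ∈ A then ⟨1, h2 j hj⟩ else
      ⟨0, h1 j⟩), fun j => ⟨Nat.zero_le _, fun hj => by simp [hj]⟩⟩
    refine basisVec_ne_zero e hA p ?_
    rw [← Submodule.mem_bot ℂ, ← h]
    exact Submodule.subset_span ⟨p, rfl⟩

theorem card_le_pairs (n : ℕ) :
    Nat.card {q : Fin n × Fin n // q.1 ≤ q.2} = (n + 1).choose 2 := by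
  rw [Nat.card_congr (Sym2.sortEquiv (α := Fin n)).symm, Nat.card_eq_fintype_card, Sym2.card,
    Fintype.card_fin]

theorem card_lt_pairs (n : ℕ) :
    Nat.card {q : Fin n × Fin n // q.1 ≤ q.2 ∧ q.1 ≠ q.2} = n.choose 2 := by
  let f : {q : {q : Fin n × Fin n // q.1 ≤ q.2} // q.1.1 ≠ q.1.2} ≃
      {a : Sym2 (Fin n) // ¬ a.IsDiag} :=
    Sym2.sortEquiv.symm.subtypeEquiv fun _ => Iff.rfl
  rw [← Nat.card_congr (Equiv.subtypeSubtypeEquivSubtypeInter _ _), Nat.card_congr f,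
    Nat.card_eq_fintype_card, Sym2.card_subtype_not_diag, Fintype.card_fin]

theorem card_admissible (A : Finset (Fin k)) : Nat.card (Admissible n A) =
    (∏ j ∈ Aᶜ, (n j + 1).choose 2) * ∏ j ∈ A, (n j).choose 2 := by
  let f : Admissible n A ≃ ∀ j, {q : Fin (n j) × Fin (n j) // q.1 ≤ q.2 ∧ (j ∈ A → q.1 ≠ q.2)} :=
    { toFun p j := ⟨(p.1.1 j, p.1.2 j), p.2 j⟩
      invFun q := ⟨(fun j => (q j).1.1, fun j => (q j).1.2), fun j => (q j).2⟩
      left_inv _ := rfl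
      right_inv _ := rfl }
  rw [Nat.card_congr f, Nat.card_pi, mul_comm, ← Finset.prod_mul_prod_compl A]
  congr 1
  · refine Finset.prod_congr rfl fun j hj => ?_
    simp only [hj, true_imp_iff]
    exact card_lt_pairs _
  · refine Finset.prod_congr rfl fun j hj => ?_
    simp only [Finset.mem_compl.1 hj, false_imp_iff, and_true]
    exact card_le_pairs _

instance (A : Finset (Fin k)) : Fintype (Admissible n A) :=
  Subtype.fintype _

include e in
theorem finrank_V {A : Finset (Fin k)} (hA : Even A.card) :
    Module.finrank ℂ (V H A).toSubmodule =
      (∏ j ∈ Aᶜ, (n j + 1).choose 2) * ∏ j ∈ A, (n j).choose 2 := by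
  rw [V_eq_span e hA, finrank_span_eq_card (linearIndependent_basisVec e hA),
    ← Nat.card_eq_fintype_card, card_admissible]

theorem exists_symPair_eq_factorIncl {A : Finset (Fin k)} (hA : Even A.card)
    (t : ⨂[ℂ] j, (factor H A j).toSubmodule) : ∃ x : SymSq H, symPair H x = factorIncl H A t := by
  have h : ∀ u : PairSpace H, u ∈ factorSpan H A → ∃ x : SymSq H, symPair H x = u := by
    intro u hu
    rw [← map_span_basisVec (fun j => stdOrthonormalBasis ℂ (H j)) hA] at hu
    obtain ⟨x, -, hx⟩ := hu
    exact ⟨x, hx⟩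
  refine h _ ?_
  induction t using PiTensorProduct.induction_on with
  | smul_tprod c s =>
    rw [map_smul, factorIncl, PiTensorProduct.mapIncl, PiTensorProduct.map_tprod]
    exact Submodule.smul_mem _ _ (Submodule.subset_span ⟨_, fun j => (s j).2, rfl⟩)
  | add x y hx hy => rw [map_add]; exact Submodule.add_mem _ hx hy

theorem exists_factorRep_equiv {A : Finset (Fin k)} (hA : Even A.card) :
    ∃ φ : (factorRep H A).Equiv (V H A).toRepresentation,
      ∀ t, regroup H (symIncl H (φ t)) = factorIncl H A t := by
  -- `g` and `factorIncl H A` are injective with the same range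
  let g : (V H A).toSubmodule →ₗ[ℂ] ⨂[ℂ] j, (H j ⊗[ℂ] H j) :=
    (regroup H ∘ₗ symIncl H) ∘ₗ (V H A).toSubmodule.subtype
  have hg : Function.Injective g := (symPair H).injective.comp Subtype.val_injective
  have hrange : LinearMap.range (factorIncl H A) = LinearMap.range g := by
    apply le_antisymm
    · rintro _ ⟨t, rfl⟩
      obtain ⟨x, hx⟩ := exists_symPair_eq_factorIncl hA t
      exact ⟨⟨x, t, hx.symm⟩, hx⟩
    · rintro _ ⟨x, rfl⟩
      exact x.2
  let φ : (⨂[ℂ] j, (factor H A j).toSubmodule) ≃ₗ[ℂ] (V H A).toSubmodule :=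
    LinearEquiv.ofInjective _ (factorIncl_injective A) ≪≫ₗ LinearEquiv.ofEq _ _ hrange ≪≫ₗ
      (LinearEquiv.ofInjective g hg).symm
  have hφ : ∀ t, g (φ t) = factorIncl H A t := fun t =>
    congrArg Subtype.val ((LinearEquiv.ofInjective g hg).apply_symm_apply _)
  refine ⟨Representation.Equiv.mk φ fun u => LinearMap.ext fun t => hg ?_, hφ⟩
  have h1 : g ((V H A).toRepresentation u (φ t)) =
      piRep (fun j => (stdRep H j).tprod (stdRep H j)) u (g (φ t)) :=
    symPair_symRep u (φ t).1
  have h2 : factorIncl H A (factorRep H A u t) =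
      piRep (fun j => (stdRep H j).tprod (stdRep H j)) u (factorIncl H A t) := by
    change (PiTensorProduct.map _ ∘ₗ PiTensorProduct.map _) t =
      (PiTensorProduct.map _ ∘ₗ PiTensorProduct.map _) t
    rw [← PiTensorProduct.map_comp, ← PiTensorProduct.map_comp]
    rfl
  exact (hφ _).trans (h2.trans ((congrArg _ (hφ t)).symm.trans h1.symm))

end

/-! ### Irreducibility and multiplicities -/

section

variable {k : ℕ} {H : Fin k → Type u} [∀ j, NormedAddCommGroup (H j)]
  [∀ j, InnerProductSpace ℂ (H j)] [∀ j, FiniteDimensional ℂ (H j)]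

theorem apply_mem_of_mem_span (W : Subrepresentation (symRep H)) {T : SymSq H →ₗ[ℂ] SymSq H}
    (hT : T ∈ Submodule.span ℂ (Set.range (symRep H))) {w : SymSq H} (hw : w ∈ W.toSubmodule) :
    T w ∈ W.toSubmodule := by
  induction hT using Submodule.span_induction with
  | mem T hT =>
    obtain ⟨g, rfl⟩ := hT
    exact W.apply_mem_toSubmodule g hw
  | zero => exact Submodule.zero_mem _
  | add S T _ _ hS hT => exact Submodule.add_mem _ hS hT
  | smul c T _ hT => exact Submodule.smul_mem _ c hT

theorem intertwining_apply_of_mem_span (W : Subrepresentation (symRep H))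
    (f : W.toRepresentation.IntertwiningMap (symRep H)) {T : SymSq H →ₗ[ℂ] SymSq H}
    (hT : T ∈ Submodule.span ℂ (Set.range (symRep H))) (w : W.toSubmodule)
    (h : T w ∈ W.toSubmodule) : f ⟨T w, h⟩ = T (f w) := by
  induction hT using Submodule.span_induction with
  | mem T hT =>
    obtain ⟨g, rfl⟩ := hT
    exact Representation.IntertwiningMap.isIntertwining _ _ f g w
  | zero => exact map_zero f
  | add S T hS hT hS' hT' =>
    exact (map_add f ⟨S w, apply_mem_of_mem_span W hS w.2⟩
      ⟨T w, apply_mem_of_mem_span W hT w.2⟩).trans (congrArg₂ (· + ·) (hS' _) (hT' _))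
  | smul c T hT hT' =>
    exact (map_smul f c ⟨T w, apply_mem_of_mem_span W hT w.2⟩).trans (congrArg (c • ·) (hT' _))

/-- Schur's lemma for the embeddings of a component in the symmetric square: applying `f` to
`|x⟩⟨y| y` in two ways expresses `f x` as a multiple of `x`, with a factor depending only on `y`. -/
theorem exists_intertwining_eq_smul {A : Finset (Fin k)}
    (f : (V H A).toRepresentation.IntertwiningMap (symRep H)) :
    ∃ c : ℂ, ∀ x : (V H A).toSubmodule, f x = c • (x : SymSq H) := by
  by_cases hV : ∃ y : (V H A).toSubmodule, y ≠ 0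
  · obtain ⟨y, hy⟩ := hV
    have hyy : inner ℂ (y : SymSq H) y ≠ 0 := by simpa using hy
    refine ⟨(inner ℂ (y : SymSq H) y)⁻¹ * inner ℂ (y : SymSq H) (f y), fun x => ?_⟩
    have hT := rankOne_mem_span_symRep x.2 y.2
    have h := intertwining_apply_of_mem_span _ f hT y (apply_mem_of_mem_span _ hT y.2)
    have e : (⟨(rankOne ℂ (x : SymSq H) (y : SymSq H) : SymSq H →L[ℂ] SymSq H).toLinearMap y,
        apply_mem_of_mem_span _ hT y.2⟩ : (V H A).toSubmodule) = inner ℂ (y : SymSq H) y • x := rfl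
    rw [e, map_smul, ContinuousLinearMap.coe_coe, rankOne_apply] at h
    rw [mul_smul, ← h, smul_smul, inv_mul_cancel₀ hyy, one_smul]
  · push Not at hV
    refine ⟨0, fun x => ?_⟩
    rw [hV x]
    simp

/-- A subrepresentation which is not orthogonal to a component contains it. -/
theorem V_le_of_inner_ne_zero {A : Finset (Fin k)} (W : Subrepresentation (symRep H))
    {w y : SymSq H} (hw : w ∈ W.toSubmodule) (hy : y ∈ (V H A).toSubmodule)
    (hyw : inner ℂ y w ≠ 0) : (V H A).toSubmodule ≤ W.toSubmodule := by
  intro x hx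
  have h := apply_mem_of_mem_span W (rankOne_mem_span_symRep hx hy) hw
  rw [ContinuousLinearMap.coe_coe, rankOne_apply] at h
  exact (Submodule.smul_mem_iff _ hyw).1 h

theorem V_isIrreducible {A : Finset (Fin k)} (hV : (V H A).toSubmodule ≠ ⊥) :
    (V H A).toRepresentation.IsIrreducible where
  exists_pair_ne := by
    refine ⟨⊥, ⊤, fun h => hV ?_⟩
    have h' : (⊥ : Submodule ℂ (V H A).toSubmodule) = ⊤ := congrArg (·.toSubmodule) h
    rw [eq_bot_iff]
    intro x hx
    have hx' : (⟨x, hx⟩ : (V H A).toSubmodule) ∈ (⊥ : Submodule ℂ (V H A).toSubmodule) :=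
      h' ▸ Submodule.mem_top
    simpa using hx'
  eq_bot_or_eq_top U := by
    by_cases hU : U.toSubmodule = ⊥
    · exact Or.inl (Subrepresentation.toSubmodule_injective hU)
    right
    obtain ⟨w, hw, hw0⟩ := Submodule.exists_mem_ne_zero_of_ne_bot hU
    let W : Subrepresentation (symRep H) :=
      ⟨U.toSubmodule.map (V H A).toSubmodule.subtype, by
        rintro g _ ⟨u, hu, rfl⟩
        exact ⟨_, U.apply_mem_toSubmodule g hu, rfl⟩⟩
    have h := V_le_of_inner_ne_zero W (w := w) (y := w) ⟨w, hw, rfl⟩ w.2 (by simpa using hw0)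
    refine Subrepresentation.toSubmodule_injective (eq_top_iff.2 fun x _ => ?_)
    obtain ⟨y, hy, hyx⟩ := h x.2
    rwa [← Subtype.ext hyx]

theorem eq_of_equiv_V {A B : Finset (Fin k)} (hA : Even A.card) (hB : Even B.card)
    (hV : (V H A).toSubmodule ≠ ⊥)
    (φ : (V H A).toRepresentation.Equiv (V H B).toRepresentation) : A = B := by
  by_contra hAB
  -- followed by the inclusion of `V_B`, the equivalence is a multiple of the inclusion of `V_A`, so
  -- that its values lie in both components
  obtain ⟨x, hx, hx0⟩ := Submodule.exists_mem_ne_zero_of_ne_bot hV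
  let f : (V H A).toRepresentation.IntertwiningMap (symRep H) :=
    { toLinearMap := (V H B).toSubmodule.subtype ∘ₗ φ.toLinearEquiv.toLinearMap
      isIntertwining' := fun g => by
        ext v
        exact congrArg Subtype.val
          (Representation.IntertwiningMap.isIntertwining _ _ φ.toIntertwiningMap g v) }
  obtain ⟨c, hc⟩ := exists_intertwining_eq_smul f
  have h1 : f ⟨x, hx⟩ = 0 := by
    have hfA : f ⟨x, hx⟩ ∈ (V H A).toSubmodule := by
      rw [hc]
      exact Submodule.smul_mem _ _ hx
    have hfB : f ⟨x, hx⟩ ∈ (V H B).toSubmodule := (φ.toLinearEquiv ⟨x, hx⟩).2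
    exact Submodule.disjoint_def.1 (V_isOrtho hA hB hAB).disjoint _ hfA hfB
  have h2 : φ.toLinearEquiv ⟨x, hx⟩ = 0 := Subtype.ext h1
  rw [LinearEquiv.map_eq_zero_iff] at h2
  exact hx0 (congrArg Subtype.val h2)

theorem exists_inner_ne_zero {w : SymSq H} (hw : w ≠ 0) :
    ∃ A : Finset (Fin k), Even A.card ∧ ∃ y ∈ (V H A).toSubmodule, inner ℂ y w ≠ 0 := by
  by_contra! h
  have h' : (⨆ A : {A : Finset (Fin k) // Even A.card}, (V H A.1).toSubmodule) ≤ (ℂ ∙ w)ᗮ := by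
    refine iSup_le fun A y hy => ?_
    rw [Submodule.mem_orthogonal_singleton_iff_inner_left]
    exact h A.1 A.2 y hy
  rw [iSup_V_eq_top, top_le_iff, Submodule.orthogonal_eq_top_iff,
    Submodule.span_singleton_eq_bot] at h'
  exact hw h'

theorem exists_eq_V_of_isIrreducible (W : Subrepresentation (symRep H))
    (hW : W.toRepresentation.IsIrreducible) :
    ∃ A : Finset (Fin k), Even A.card ∧ (V H A).toSubmodule ≠ ⊥ ∧ W = V H A := by
  have hne : W.toSubmodule ≠ ⊥ := by
    intro h
    obtain ⟨U, U', hU⟩ := hW.exists_pair_ne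
    refine hU (Subrepresentation.toSubmodule_injective ?_)
    have := (Submodule.subsingleton_iff_eq_bot (p := W.toSubmodule)).2 h
    exact Subsingleton.elim _ _
  obtain ⟨w, hw, hw0⟩ := Submodule.exists_mem_ne_zero_of_ne_bot hne
  obtain ⟨A, hA, y, hy, hyw⟩ := exists_inner_ne_zero hw0
  have hle := V_le_of_inner_ne_zero W hw hy hyw
  have hy0 : y ≠ 0 := by rintro rfl; simp at hyw
  refine ⟨A, hA, fun h => hy0 (by simpa [h] using hy), ?_⟩
  let U : Subrepresentation W.toRepresentation :=
    ⟨(V H A).toSubmodule.comap W.toSubmodule.subtype, fun g _ hv =>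
      (V H A).apply_mem_toSubmodule g hv⟩
  rcases hW.eq_bot_or_eq_top U with h | h
  · have h' : U.toSubmodule = ⊥ := congrArg (·.toSubmodule) h
    have : (⟨y, hle hy⟩ : W.toSubmodule) ∈ U.toSubmodule := hy
    rw [h', Submodule.mem_bot] at this
    exact absurd (congrArg Subtype.val this) hy0
  · have h' : U.toSubmodule = ⊤ := congrArg (·.toSubmodule) h
    refine Subrepresentation.toSubmodule_injective (le_antisymm (fun x hx => ?_) hle)
    have : (⟨x, hx⟩ : W.toSubmodule) ∈ U.toSubmodule := h' ▸ Submodule.mem_top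
    exact this

theorem V_injective {A B : Finset (Fin k)} (hA : Even A.card) (hB : Even B.card)
    (hV : (V H A).toSubmodule ≠ ⊥) (h : V H A = V H B) : A = B := by
  by_contra hAB
  have h' := V_isOrtho (H := H) hA hB hAB
  rw [← h, Submodule.isOrtho_self] at h'
  exact hV h'

theorem finrank_intertwiningMap_V {A : Finset (Fin k)} (hV : (V H A).toSubmodule ≠ ⊥) :
    Module.finrank ℂ ((V H A).toRepresentation.IntertwiningMap (symRep H)) = 1 := by
  obtain ⟨x, hx, hx0⟩ := Submodule.exists_mem_ne_zero_of_ne_bot hV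
  let ι : (V H A).toRepresentation.IntertwiningMap (symRep H) :=
    { toLinearMap := (V H A).toSubmodule.subtype
      isIntertwining' := fun g => rfl }
  have hι : ι ≠ 0 := fun h => hx0 (congrArg (fun f => f.toLinearMap ⟨x, hx⟩) h)
  rw [finrank_eq_one_iff_of_nonzero' ι hι]
  intro f
  obtain ⟨c, hc⟩ := exists_intertwining_eq_smul f
  refine ⟨c, Representation.IntertwiningMap.ext (LinearMap.ext fun y => ?_)⟩
  exact (hc y).symm

/-! ### Operators commuting with the local unitary group -/

variable (H) in
/-- The orthogonal projection of `S²(H₁ ⊗ ⋯ ⊗ H_k)` onto `V_A`, as a linear map. -/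
def proj (A : Finset (Fin k)) : SymSq H →ₗ[ℂ] SymSq H :=
  ((V H A).toSubmodule.starProjection : SymSq H →L[ℂ] SymSq H).toLinearMap

theorem proj_apply_of_mem {A : Finset (Fin k)} {x : SymSq H} (hx : x ∈ (V H A).toSubmodule) :
    proj H A x = x :=
  Submodule.starProjection_eq_self_iff.2 hx

theorem proj_apply_of_mem_of_ne {A B : Finset (Fin k)} (hA : Even A.card) (hB : Even B.card)
    (hAB : A ≠ B) {x : SymSq H} (hx : x ∈ (V H B).toSubmodule) : proj H A x = 0 :=
  (Submodule.starProjection_apply_eq_zero_iff _).2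
    (Submodule.isOrtho_iff_le.1 (V_isOrtho hB hA hAB.symm) hx)

theorem mem_span_proj_of_commute {T : SymSq H →ₗ[ℂ] SymSq H}
    (hT : ∀ g, T ∘ₗ symRep H g = symRep H g ∘ₗ T) : T ∈ Submodule.span ℂ (Set.range
      fun A : {A : Finset (Fin k) // Even A.card ∧ (V H A).toSubmodule ≠ ⊥} => proj H A.1) := by
  classical
  have h : ∀ A : Finset (Fin k), ∃ c : ℂ, ∀ x ∈ (V H A).toSubmodule, T x = c • x := by
    intro A
    obtain ⟨c, hc⟩ := exists_intertwining_eq_smul (A := A)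
      { toLinearMap := T ∘ₗ (V H A).toSubmodule.subtype
        isIntertwining' := fun g => by
          ext v
          exact LinearMap.congr_fun (hT g) v }
    exact ⟨c, fun x hx => hc ⟨x, hx⟩⟩
  choose c hc using h
  have e : T = ∑ A : Finset (Fin k) with Even A.card ∧ (V H A).toSubmodule ≠ ⊥, c A • proj H A := by
    have hle : (⨆ A : {A : Finset (Fin k) // Even A.card}, (V H A.1).toSubmodule) ≤
        LinearMap.eqLocus T
          (∑ A : Finset (Fin k) with Even A.card ∧ (V H A).toSubmodule ≠ ⊥, c A • proj H A) := by
      refine iSup_le fun B x hx => ?_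
      rw [LinearMap.mem_eqLocus, LinearMap.sum_apply]
      by_cases hx0 : x = 0
      · simp [hx0]
      have hB : (V H B.1).toSubmodule ≠ ⊥ := fun hbot => hx0 (by simpa [hbot] using hx)
      rw [Finset.sum_eq_single B.1]
      · rw [LinearMap.smul_apply, proj_apply_of_mem hx, hc B.1 x hx]
      · intro A hA hAB
        rw [LinearMap.smul_apply,
          proj_apply_of_mem_of_ne (Finset.mem_filter.1 hA).2.1 B.2 hAB hx, smul_zero]
      · intro hB'
        exact absurd (Finset.mem_filter.2 ⟨Finset.mem_univ _, B.2, hB⟩) hB'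
    rw [iSup_V_eq_top] at hle
    exact LinearMap.ext fun x => hle (Submodule.mem_top (x := x))
  rw [e]
  exact Submodule.sum_mem _ fun A hA => Submodule.smul_mem _ _
    (Submodule.subset_span ⟨⟨A, (Finset.mem_filter.1 hA).2⟩, rfl⟩)

theorem linearIndependent_proj : LinearIndependent ℂ
    fun A : {A : Finset (Fin k) // Even A.card ∧ (V H A).toSubmodule ≠ ⊥} => proj H A.1 := by
  rw [linearIndependent_iff']
  intro s c hc B hB
  obtain ⟨x, hx, hx0⟩ := Submodule.exists_mem_ne_zero_of_ne_bot B.2.2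
  have h := LinearMap.congr_fun hc x
  rw [LinearMap.sum_apply, Finset.sum_eq_single B, LinearMap.smul_apply, proj_apply_of_mem hx,
    LinearMap.zero_apply, smul_eq_zero] at h
  · exact h.resolve_right hx0
  · intro A _ hAB
    rw [LinearMap.smul_apply,
      proj_apply_of_mem_of_ne A.2.1 B.2.1 (fun h' => hAB (Subtype.ext h')) hx, smul_zero]
  · exact fun h' => absurd hB h'

theorem inner_symRep (g : LU H) (x y : SymSq H) :
    inner ℂ (symRep H g x) (symRep H g y) = inner ℂ x y := by
  have h : ∀ u v : PairSpace H, inner ℂ (pairRep H g u) (pairRep H g v) = inner ℂ u v := by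
    have hprod : ∀ s : ∀ j, H j ⊗[ℂ] H j, pairRep H g (prodVec (H := fun j => H j ⊗[ℂ] H j) s) =
        prodVec (H := fun j => H j ⊗[ℂ] H j) fun j =>
          TensorProduct.map (g j).toLinearIsometry.toLinearMap (g j).toLinearIsometry.toLinearMap
            (s j) :=
      fun s => PiTensorProduct.map_tprod _ s
    intro u v
    induction u using prodVec_induction with
    | smul c u hu => rw [map_smul, inner_smul_left, inner_smul_left, hu]
    | add u u' hu hu' => rw [map_add, inner_add_left, inner_add_left, hu, hu']
    | prod s =>
      induction v using prodVec_induction with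
      | smul c v hv => rw [map_smul, inner_smul_right, inner_smul_right, hv]
      | add v v' hv hv' => rw [map_add, inner_add_right, inner_add_right, hv, hv']
      | prod t =>
        rw [hprod, hprod, inner_prodVec, inner_prodVec]
        exact Finset.prod_congr rfl fun j _ => inner_map_map _ _ _ _
  rw [← (symPair H).inner_map_map, symPair_symRep, symPair_symRep, h, (symPair H).inner_map_map]

theorem proj_comp_symRep (A : Finset (Fin k)) (g : LU H) :
    proj H A ∘ₗ symRep H g = symRep H g ∘ₗ proj H A := by
  refine LinearMap.ext fun x => Submodule.eq_starProjection_of_mem_of_inner_eq_zero ?_ ?_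
  · exact (V H A).apply_mem_toSubmodule g (Submodule.starProjection_apply_mem _ x)
  · intro w hw
    have h1 : w = symRep H g (symRep H g⁻¹ w) := by
      rw [← Module.End.mul_apply, ← map_mul, mul_inv_cancel, map_one, Module.End.one_apply]
    rw [LinearMap.comp_apply, ← map_sub, h1, inner_symRep]
    exact Submodule.starProjection_inner_eq_zero x _ ((V H A).apply_mem_toSubmodule g⁻¹ hw)

end

/-! ### Quartic forms and polarization -/

section

variable {k : ℕ} {H : Fin k → Type u} [∀ j, NormedAddCommGroup (H j)]
  [∀ j, InnerProductSpace ℂ (H j)] [∀ j, FiniteDimensional ℂ (H j)]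

variable (H) in
/-- The function `ψ ↦ ⟨ψ², T ψ²⟩` defined by an operator `T` on the symmetric square. -/
def quartic : (SymSq H →ₗ[ℂ] SymSq H) →ₗ[ℂ] (StateSpace H → ℂ) where
  toFun T ψ := inner ℂ (sqMul ψ ψ) (T (sqMul ψ ψ))
  map_add' _ _ := funext fun _ => inner_add_right _ _ _
  map_smul' _ _ := funext fun _ => inner_smul_right _ _ _

theorem sqMul_add_smul_self (x y : StateSpace H) (c : ℂ) : sqMul (x + c • y) (x + c • y) =
    sqMul x x + (2 * c) • sqMul x y + (c * c) • sqMul y y := by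
  have h := sqMul_comm y x
  simp only [← sqMulBilin_apply, map_add, map_smul, LinearMap.add_apply,
    LinearMap.smul_apply] at h ⊢
  rw [h]
  module

theorem span_sqMul_self :
    Submodule.span ℂ (Set.range fun ψ : StateSpace H => sqMul ψ ψ) = ⊤ := by
  rw [eq_top_iff, ← span_sqMul_compBasis fun j => stdOrthonormalBasis ℂ (H j), Submodule.span_le]
  rintro _ ⟨i, rfl⟩
  have e : ∀ x y : StateSpace H, sqMul x y =
      (1 / 2 : ℂ) • (sqMul (x + (1 : ℂ) • y) (x + (1 : ℂ) • y) - sqMul x x - sqMul y y) := by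
    intro x y
    rw [sqMul_add_smul_self]
    module
  have m : ∀ x : StateSpace H, sqMul x x ∈ Submodule.span ℂ
      (Set.range fun ψ : StateSpace H => sqMul ψ ψ) := fun x => Submodule.subset_span ⟨x, rfl⟩
  simp only [SetLike.mem_coe]
  rw [e]
  exact Submodule.smul_mem _ _ (Submodule.sub_mem _ (Submodule.sub_mem _ (m _) (m _)) (m _))

theorem inner_sqMul_eq_zero_of_quartic_eq_zero {T : SymSq H →ₗ[ℂ] SymSq H} (hT : quartic H T = 0)
    (x y : StateSpace H) : inner ℂ (sqMul x x) (T (sqMul y y)) = 0 := by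
  have hq : ∀ ψ, inner ℂ (sqMul ψ ψ) (T (sqMul ψ ψ)) = 0 := fun ψ => congrFun hT ψ
  -- averaging over fourth roots of unity isolates the terms of weight `±2` in `y`
  have h1 : ∀ x y, inner ℂ (sqMul x x) (T (sqMul y y)) +
      inner ℂ (sqMul y y) (T (sqMul x x)) = 0 := by
    intro x y
    have hc : ∀ c s : ℂ, c * c = s → starRingEnd ℂ s = s →
        starRingEnd ℂ c * c = 1 → s * s = 1 →
        inner ℂ (sqMul x x) (T (sqMul x x)) + inner ℂ (sqMul y y) (T (sqMul y y)) +
          4 * inner ℂ (sqMul x y) (T (sqMul x y)) +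
          s * (inner ℂ (sqMul x x) (T (sqMul y y)) + inner ℂ (sqMul y y) (T (sqMul x x))) +
          c * (2 * inner ℂ (sqMul x x) (T (sqMul x y)) +
            2 * s * inner ℂ (sqMul y y) (T (sqMul x y))) +
          starRingEnd ℂ c * (2 * inner ℂ (sqMul x y) (T (sqMul x x)) +
            2 * s * inner ℂ (sqMul x y) (T (sqMul y y))) = 0 := by
      intro c s hs hs' h1 hss
      have h := hq (x + c • y)
      simp only [sqMul_add_smul_self, map_add, map_smul, inner_add_left, inner_add_right,
        inner_smul_left, inner_smul_right, map_mul, hs, hs', map_ofNat] at h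
      linear_combination h - 4 * inner ℂ (sqMul x y) (T (sqMul x y)) * h1
        - inner ℂ (sqMul y y) (T (sqMul y y)) * hss
    have a1 := hc 1 1 (by simp) (by simp) (by simp) (by simp)
    have a2 := hc (-1) 1 (by simp) (by simp) (by simp) (by simp)
    have a3 := hc Complex.I (-1) (by simp) (by simp) (by simp) (by simp)
    have a4 := hc (-Complex.I) (-1) (by simp) (by simp) (by simp) (by simp)
    simp only [map_neg, map_one, Complex.conj_I] at a1 a2 a3 a4
    linear_combination (a1 + a2 - a3 - a4) / 4
  -- rotating `y` by an eighth root of unity separates the two terms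
  obtain ⟨ζ, hζ⟩ := IsAlgClosed.exists_pow_nat_eq Complex.I (n := 2) (by norm_num)
  have hζ' : starRingEnd ℂ ζ * starRingEnd ℂ ζ = -Complex.I := by
    rw [← map_mul, ← sq, hζ, Complex.conj_I]
  have h2 := h1 x (ζ • y)
  have e : sqMul (ζ • y) (ζ • y) = (ζ * ζ) • sqMul y y := by
    simp only [← sqMulBilin_apply, map_smul, LinearMap.smul_apply, smul_smul]
  rw [e, map_smul, inner_smul_left, inner_smul_right, map_mul, hζ', ← sq, hζ] at h2
  have h3 := h1 x y
  linear_combination (h3 - Complex.I * h2 + (inner ℂ (sqMul x x) (T (sqMul y y)) -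
    inner ℂ (sqMul y y) (T (sqMul x x))) * Complex.I_mul_I) / 2

/-- An operator on the symmetric square is determined by its values on squares. -/
theorem quartic_injective : Function.Injective (quartic H) := by
  rw [← LinearMap.ker_eq_bot, LinearMap.ker_eq_bot']
  intro T hT
  refine LinearMap.ext fun t => ext_inner_left ℂ fun s => ?_
  rw [LinearMap.zero_apply, inner_zero_right]
  have hs : s ∈ Submodule.span ℂ (Set.range fun ψ : StateSpace H => sqMul ψ ψ) := by
    simp [span_sqMul_self]
  have ht : t ∈ Submodule.span ℂ (Set.range fun ψ : StateSpace H => sqMul ψ ψ) := by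
    simp [span_sqMul_self]
  induction hs, ht using Submodule.span_induction₂ with
  | mem_mem s t hs ht =>
    obtain ⟨x, rfl⟩ := hs
    obtain ⟨y, rfl⟩ := ht
    exact inner_sqMul_eq_zero_of_quartic_eq_zero hT x y
  | zero_left => simp
  | zero_right => simp
  | add_left x x' y _ _ _ h h' => rw [inner_add_left, h, h', add_zero]
  | add_right x y y' _ _ _ h h' => rw [map_add, inner_add_right, h, h', add_zero]
  | smul_left c x y _ _ h => rw [inner_smul_left, h, mul_zero]
  | smul_right c x y _ _ h => rw [map_smul, inner_smul_right, h, mul_zero]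

theorem symRep_sqMul (g : LU H) (x y : StateSpace H) :
    symRep H g (sqMul x y) = sqMul (stateRep H g x) (stateRep H g y) := by
  apply Subtype.ext
  change TensorProduct.map (stateRep H g) (stateRep H g) ((1 / 2 : ℂ) • (x ⊗ₜ[ℂ] y + y ⊗ₜ[ℂ] x)) = _
  rw [map_smul, map_add, map_tmul, map_tmul]
  rfl

theorem quartic_invariant_of_commute {T : SymSq H →ₗ[ℂ] SymSq H}
    {g : LU H} (hT : T ∘ₗ symRep H g = symRep H g ∘ₗ T) (ψ : StateSpace H) :
    quartic H T (stateRep H g ψ) = quartic H T ψ := by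
  change inner ℂ (sqMul (stateRep H g ψ) (stateRep H g ψ))
    (T (sqMul (stateRep H g ψ) (stateRep H g ψ))) = _
  rw [← symRep_sqMul, ← LinearMap.comp_apply, hT, LinearMap.comp_apply, inner_symRep]
  rfl

/-- Since `T` is determined by its quartic form, conjugation by `g` fixes `T` if it fixes
the form. -/
theorem commute_of_quartic_invariant {T : SymSq H →ₗ[ℂ] SymSq H} {g : LU H}
    (hT : ∀ ψ, quartic H T (stateRep H g ψ) = quartic H T ψ) :
    T ∘ₗ symRep H g = symRep H g ∘ₗ T := by
  have hg : ∀ x, symRep H g (symRep H g⁻¹ x) = x := fun x => by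
    rw [← Module.End.mul_apply, ← map_mul, mul_inv_cancel, map_one, Module.End.one_apply]
  have h : symRep H g⁻¹ ∘ₗ T ∘ₗ symRep H g = T := by
    refine quartic_injective (funext fun ψ => ?_)
    rw [← hT ψ]
    change inner ℂ (sqMul ψ ψ) (symRep H g⁻¹ (T (symRep H g (sqMul ψ ψ)))) =
      inner ℂ (sqMul (stateRep H g ψ) (stateRep H g ψ))
        (T (sqMul (stateRep H g ψ) (stateRep H g ψ)))
    rw [← inner_symRep g, hg, ← symRep_sqMul]
  refine LinearMap.ext fun x => ?_
  rw [LinearMap.comp_apply, LinearMap.comp_apply]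
  conv_rhs => rw [← h]
  rw [LinearMap.comp_apply, hg, LinearMap.comp_apply]

/-! ### The explicit formula for the invariants -/

variable {n : Fin k → ℕ} (e : ∀ j, OrthonormalBasis (Fin (n j)) ℂ (H j))

theorem inner_basisVec_sqMul_self {A : Finset (Fin k)} (hA : Even A.card)
    (p : (∀ j, Fin (n j)) × (∀ j, Fin (n j))) (ψ : StateSpace H) :
    inner ℂ (basisVec e A p) (sqMul ψ ψ) =
      ∑ b, bitSign A b * coeff e ψ (pick p b) * coeff e ψ (pick p (flipBits b)) := by
  have h : symIncl H (sqMul ψ ψ) = ψ ⊗ₜ[ℂ] ψ := symMul_self ψ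
  rw [inner_def, symIncl_basisVec e hA, h, sum_inner]
  refine Finset.sum_congr rfl fun b _ => ?_
  rw [inner_tensor_smul_left, conj_bitSign, inner_tmul, mul_assoc]
  rfl

theorem proj_apply_eq_sum {A : Finset (Fin k)} (hA : Even A.card) (x : SymSq H) :
    proj H A x = ∑ p : Admissible n A,
      (((2 : ℂ) ^ (k + agree p.1))⁻¹ * inner ℂ (basisVec e A p.1) x) • basisVec e A p.1 := by
  refine Submodule.eq_starProjection_of_mem_of_inner_eq_zero ?_ ?_
  · exact Submodule.sum_mem _ fun p _ => Submodule.smul_mem _ _ (basisVec_mem e hA p.1)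
  · intro w hw
    rw [V_eq_span e hA] at hw
    induction hw using Submodule.span_induction with
    | zero => simp
    | add w w' _ _ h h' => rw [inner_add_right, h, h', add_zero]
    | smul c w _ h => rw [inner_smul_right, h, mul_zero]
    | mem w hw =>
      obtain ⟨q, rfl⟩ := hw
      have hn : inner ℂ (basisVec e A q.1) (basisVec e A q.1) = (2 : ℂ) ^ (k + agree q.1) :=
        inner_basisVec_self e hA (fun j => (q.2 j).1) (fun j => (q.2 j).2)
      rw [← inner_conj_symm, inner_sub_right, inner_sum, Finset.sum_eq_single q, inner_smul_right,
        hn, mul_right_comm, inv_mul_cancel₀ (pow_ne_zero _ two_ne_zero), one_mul, sub_self,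
        map_zero]
      · intro p _ hp
        rw [inner_smul_right, inner_basisVec_admissible e hA hp.symm, mul_zero]
      · exact fun h => absurd (Finset.mem_univ q) h

theorem invariant_eq_invariantFormula {A : Finset (Fin k)} (hA : Even A.card) (ψ : StateSpace H) :
    invariant A ψ = (invariantFormula e A ψ : ℂ) := by
  have h1 : invariant A ψ = ∑ p : Admissible n A, ((2 : ℂ) ^ (k + agree p.1))⁻¹ *
      (‖inner ℂ (basisVec e A p.1) (sqMul ψ ψ)‖ : ℂ) ^ 2 := by
    change inner ℂ (sqMul ψ ψ) (proj H A (sqMul ψ ψ)) = _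
    rw [proj_apply_eq_sum e hA, inner_sum]
    refine Finset.sum_congr rfl fun p _ => ?_
    rw [inner_smul_right, mul_assoc, ← inner_conj_symm (sqMul ψ ψ), RCLike.mul_conj]
    rfl
  have h2 : ∑ p : Admissible n A, ((2 : ℂ) ^ (k + agree p.1))⁻¹ *
      (‖inner ℂ (basisVec e A p.1) (sqMul ψ ψ)‖ : ℂ) ^ 2 =
      ∑ p : (∀ j, Fin (n j)) × (∀ j, Fin (n j)) with ∀ j, p.1 j ≤ p.2 j ∧ (j ∈ A → p.1 j ≠ p.2 j),
        ((2 : ℂ) ^ (k + agree p))⁻¹ * (‖inner ℂ (basisVec e A p) (sqMul ψ ψ)‖ : ℂ) ^ 2 :=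
    (Finset.sum_subtype _ (p := fun p => ∀ j, p.1 j ≤ p.2 j ∧ (j ∈ A → p.1 j ≠ p.2 j))
      (fun p => by simp) fun p => ((2 : ℂ) ^ (k + agree p))⁻¹ *
        (‖inner ℂ (basisVec e A p) (sqMul ψ ψ)‖ : ℂ) ^ 2).symm
  rw [h1, h2, invariantFormula, Complex.ofReal_mul, Complex.ofReal_sum, Finset.mul_sum]
  have h3 : Finset.univ.filter (fun p : (∀ j, Fin (n j)) × (∀ j, Fin (n j)) =>
      ∀ j, p.1 j ≤ p.2 j ∧ (j ∈ A → p.1 j ≠ p.2 j)) ⊆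
      Finset.univ.filter fun p => ∀ j, p.1 j ≤ p.2 j :=
    Finset.monotone_filter_right _ fun p _ hp j => (hp j).1
  rw [Finset.sum_subset h3]
  · refine Finset.sum_congr rfl fun p _ => ?_
    rw [inner_basisVec_sqMul_self e hA]
    push_cast
    rw [pow_add, mul_inv, mul_assoc]
  · intro p hp hp'
    simp only [Finset.mem_filter, Finset.mem_univ, true_and] at hp hp'
    push Not at hp'
    obtain ⟨j, hj⟩ := hp'
    obtain ⟨hjA, hj⟩ := hj (hp j)
    rw [basisVec_eq_zero e hA hp hjA hj]
    simp

end

/-! ### Invariant polynomials of degree four -/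

section

variable {k : ℕ} {H : Fin k → Type u} [∀ j, NormedAddCommGroup (H j)]
  [∀ j, InnerProductSpace ℂ (H j)] [∀ j, FiniteDimensional ℂ (H j)]

variable {n : Fin k → ℕ} (e : ∀ j, OrthonormalBasis (Fin (n j)) ℂ (H j))

/-- The values at `ψ` of the coordinates (`Sum.inl` variables) and their conjugates (`Sum.inr`
variables). -/
def coordVal (ψ : StateSpace H) : (∀ j, Fin (n j)) ⊕ (∀ j, Fin (n j)) → ℂ :=
  Sum.elim (coeff e ψ) fun i => (starRingEnd ℂ) (coeff e ψ i)

theorem coeff_smul (c : ℂ) (ψ : StateSpace H) (i : ∀ j, Fin (n j)) :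
    coeff e (c • ψ) i = c * coeff e ψ i :=
  inner_smul_right _ _ _

theorem coordVal_smul (c : ℂ) (ψ : StateSpace H) (x : (∀ j, Fin (n j)) ⊕ (∀ j, Fin (n j))) :
    coordVal e (c • ψ) x = Sum.elim (fun _ => c) (fun _ => starRingEnd ℂ c) x * coordVal e ψ x := by
  cases x <;> simp [coordVal, coeff_smul]

theorem coeff_mul_coeff (ψ : StateSpace H) (i i' : ∀ j, Fin (n j)) :
    coeff e ψ i * coeff e ψ i' = inner ℂ (sqMul (compBasis e i) (compBasis e i')) (sqMul ψ ψ) := by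
  have h : symIncl H (sqMul ψ ψ) = ψ ⊗ₜ[ℂ] ψ := symMul_self ψ
  rw [inner_def, symIncl_sqMul, h, inner_tensor_smul_left, inner_add_left, inner_tmul, inner_tmul]
  simp only [coeff, map_div₀, map_one, map_ofNat]
  ring

/-- Every monomial of bidegree `(2, 2)` is the quartic form of a dyad. -/
theorem coeff_quadruple_eq_quartic (a b c d : ∀ j, Fin (n j)) (ψ : StateSpace H) :
    quartic H (rankOne ℂ (sqMul (compBasis e c) (compBasis e d))
      (sqMul (compBasis e a) (compBasis e b)) : SymSq H →L[ℂ] SymSq H).toLinearMap ψ =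
      coeff e ψ a * coeff e ψ b *
        (starRingEnd ℂ (coeff e ψ c) * starRingEnd ℂ (coeff e ψ d)) := by
  rw [← map_mul, coeff_mul_coeff, coeff_mul_coeff, inner_conj_symm, ← inner_smul_right]
  rfl

/-- The average of a function over the multiplications by the cube roots of unity `1, ω, ω²`. -/
def cubeAverage (ω : ℂ) : (StateSpace H → ℂ) →ₗ[ℂ] (StateSpace H → ℂ) where
  toFun f ψ := (1 / 3) * (f ψ + f (ω • ψ) + f (ω • ω • ψ))
  map_add' _ _ := funext fun _ => by simp only [Pi.add_apply]; ring
  map_smul' _ _ := funext fun _ => by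
    simp only [Pi.smul_apply, smul_eq_mul, RingHom.id_apply]; ring

theorem cubeAverage_eq_self {ω : ℂ} {f : StateSpace H → ℂ} (hf : ∀ ψ, f (ω • ψ) = f ψ) :
    cubeAverage ω f = f := by
  funext ψ
  change (1 / 3) * (f ψ + f (ω • ψ) + f (ω • ω • ψ)) = f ψ
  rw [hf (ω • ψ), hf ψ]
  ring

/-- Under a phase `ω`, a product of `a` coordinates and `4 - a` conjugate coordinates is multiplied
by `ω ^ (2 a - 4)`, which for a primitive cube root of unity is trivial only for `a = 2`. -/
theorem cubeAverage_quadruple_mem {ω : ℂ} (hω : 1 + ω + ω ^ 2 = 0)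
    (hω' : starRingEnd ℂ ω = ω ^ 2) (x y z w : (∀ j, Fin (n j)) ⊕ (∀ j, Fin (n j))) :
    cubeAverage ω (fun ψ : StateSpace H =>
      coordVal e ψ x * coordVal e ψ y * coordVal e ψ z * coordVal e ψ w) ∈
      LinearMap.range (quartic H) := by
  have h3 : ω ^ 3 = 1 := by linear_combination (ω - 1) * hω
  have hbal : ∀ a b c d : ∀ j, Fin (n j), ∀ f : StateSpace H → ℂ, (∀ ψ, f ψ = coeff e ψ a *
      coeff e ψ b * (starRingEnd ℂ (coeff e ψ c) * starRingEnd ℂ (coeff e ψ d))) →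
      cubeAverage ω f ∈ LinearMap.range (quartic H) := by
    intro a b c d f hf
    have hinv : ∀ ψ, f (ω • ψ) = f ψ := by
      intro ψ
      rw [hf, hf]
      simp only [coeff_smul, map_mul, hω']
      linear_combination coeff e ψ a * coeff e ψ b *
        (starRingEnd ℂ (coeff e ψ c) * starRingEnd ℂ (coeff e ψ d)) * (ω ^ 3 + 1) * h3
    rw [cubeAverage_eq_self hinv]
    exact ⟨_, funext fun ψ => (coeff_quadruple_eq_quartic e a b c d ψ).trans (hf ψ).symm⟩
  have hunbal : ∀ (f : StateSpace H → ℂ) (μ : ℂ), 1 + μ + μ ^ 2 = 0 →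
      (∀ ψ, f (ω • ψ) = μ * f ψ) → cubeAverage ω f ∈ LinearMap.range (quartic H) := by
    intro f μ hμ hf
    have h0 : cubeAverage ω f = 0 := by
      funext ψ
      change (1 / 3) * (f ψ + f (ω • ψ) + f (ω • ω • ψ)) = 0
      rw [hf (ω • ψ), hf ψ]
      linear_combination (1 / 3) * f ψ * hμ
    rw [h0]
    exact Submodule.zero_mem _
  have h4 : 1 + ω ^ 4 + (ω ^ 4) ^ 2 = 0 := by
    linear_combination hω + (ω + ω ^ 2 * (ω ^ 3 + 1)) * h3
  have h5 : 1 + ω ^ 5 + (ω ^ 5) ^ 2 = 0 := by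
    linear_combination hω + (ω ^ 2 + ω * (ω ^ 6 + ω ^ 3 + 1)) * h3
  have h7 : 1 + ω ^ 7 + (ω ^ 7) ^ 2 = 0 := by
    linear_combination hω + (ω * (ω ^ 3 + 1) + ω ^ 2 * (ω ^ 9 + ω ^ 6 + ω ^ 3 + 1)) * h3
  have h8 : 1 + ω ^ 8 + (ω ^ 8) ^ 2 = 0 := by
    linear_combination hω +
      (ω ^ 2 * (ω ^ 3 + 1) + ω * (ω ^ 12 + ω ^ 9 + ω ^ 6 + ω ^ 3 + 1)) * h3
  have hsm : ∀ ψ : StateSpace H, coordVal e (ω • ψ) x * coordVal e (ω • ψ) y *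
      coordVal e (ω • ψ) z * coordVal e (ω • ψ) w = _ := fun ψ => by
    rw [coordVal_smul, coordVal_smul, coordVal_smul, coordVal_smul]
  rcases x with a | a <;> rcases y with b | b <;> rcases z with c | c <;> rcases w with d | d <;>
    simp only [Sum.elim_inl, Sum.elim_inr, hω'] at hsm <;>
    first
    | exact hunbal _ _ h4 fun ψ => (hsm ψ).trans (by ring1)
    | exact hunbal _ _ h5 fun ψ => (hsm ψ).trans (by ring1)
    | exact hunbal _ _ h7 fun ψ => (hsm ψ).trans (by ring1)
    | exact hunbal _ _ h8 fun ψ => (hsm ψ).trans (by ring1)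
    | exact hbal a b c d _ fun ψ => by simp only [coordVal, Sum.elim_inl, Sum.elim_inr]; ring1
    | exact hbal a c b d _ fun ψ => by simp only [coordVal, Sum.elim_inl, Sum.elim_inr]; ring1
    | exact hbal a d b c _ fun ψ => by simp only [coordVal, Sum.elim_inl, Sum.elim_inr]; ring1
    | exact hbal b c a d _ fun ψ => by simp only [coordVal, Sum.elim_inl, Sum.elim_inr]; ring1
    | exact hbal b d a c _ fun ψ => by simp only [coordVal, Sum.elim_inl, Sum.elim_inr]; ring1
    | exact hbal c d a b _ fun ψ => by simp only [coordVal, Sum.elim_inl, Sum.elim_inr]; ring1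

theorem cubeAverage_eval_mem {ω : ℂ} (hω : 1 + ω + ω ^ 2 = 0)
    (hω' : starRingEnd ℂ ω = ω ^ 2)
    {P : MvPolynomial ((∀ j, Fin (n j)) ⊕ (∀ j, Fin (n j))) ℂ} (hP : P.IsHomogeneous 4) :
    cubeAverage ω (fun ψ : StateSpace H => MvPolynomial.eval (coordVal e ψ) P) ∈
      LinearMap.range (quartic H) := by
  have hsum : (fun ψ : StateSpace H => MvPolynomial.eval (coordVal e ψ) P) =
      ∑ s ∈ P.support, P.coeff s •
        fun ψ => MvPolynomial.eval (coordVal e ψ) (MvPolynomial.monomial s 1) := by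
    funext ψ
    conv_lhs => rw [P.as_sum, map_sum]
    rw [Finset.sum_apply]
    refine Finset.sum_congr rfl fun s _ => ?_
    rw [Pi.smul_apply, smul_eq_mul, MvPolynomial.eval_monomial, MvPolynomial.eval_monomial, one_mul]
  rw [hsum, map_sum]
  refine Submodule.sum_mem _ fun s hs => ?_
  rw [map_smul]
  refine Submodule.smul_mem _ _ ?_
  have hd : s.degree = 4 :=
    (Finsupp.degree_eq_weight_one (R := ℕ) ▸ hP (MvPolynomial.mem_support_iff.1 hs) :)
  -- a monomial of positive degree is a variable times a monomial of smaller degree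
  have hstep : ∀ (d : ℕ) (s : (∀ j, Fin (n j)) ⊕ (∀ j, Fin (n j)) →₀ ℕ), s.degree = d + 1 →
      ∃ x s', s'.degree = d ∧ ∀ v : (∀ j, Fin (n j)) ⊕ (∀ j, Fin (n j)) → ℂ,
        MvPolynomial.eval v (MvPolynomial.monomial s 1) =
          v x * MvPolynomial.eval v (MvPolynomial.monomial s' 1) := by
    intro d s hs
    have hs0 : s ≠ 0 := by rintro rfl; simp at hs
    obtain ⟨x, hx⟩ := Finsupp.support_nonempty_iff.2 hs0
    have hle : Finsupp.single x 1 ≤ s := by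
      rw [Finsupp.single_le_iff]
      exact Nat.one_le_iff_ne_zero.2 (Finsupp.mem_support_iff.1 hx)
    have hadd : s = Finsupp.single x 1 + (s - Finsupp.single x 1) :=
      (add_tsub_cancel_of_le hle).symm
    refine ⟨x, s - Finsupp.single x 1, ?_, fun v => ?_⟩
    · rw [hadd, map_add, Finsupp.degree_single] at hs
      omega
    · conv_lhs => rw [hadd, ← one_mul (1 : ℂ), ← MvPolynomial.monomial_mul, map_mul]
      congr 1
      exact MvPolynomial.eval_X x
  obtain ⟨x, s₁, h₁, e₁⟩ := hstep 3 s hd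
  obtain ⟨y, s₂, h₂, e₂⟩ := hstep 2 s₁ h₁
  obtain ⟨z, s₃, h₃, e₃⟩ := hstep 1 s₂ h₂
  obtain ⟨w, s₄, h₄, e₄⟩ := hstep 0 s₃ h₃
  rw [Finsupp.degree_eq_zero_iff] at h₄
  convert cubeAverage_quadruple_mem e hω hω' x y z w using 2
  funext ψ
  rw [e₁, e₂, e₃, e₄, h₄]
  simp
  ring

/-- A global phase is a local unitary operator, acting on the first factor only. -/
theorem exists_stateRep_eq_smul (hk : 1 ≤ k) {z : ℂ} (hz : starRingEnd ℂ z * z = 1) :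
    ∃ g : LU H, ∀ ψ, stateRep H g ψ = z • ψ := by
  have h : ∀ j, ∃ u : H j ≃ₗᵢ[ℂ] H j, ∀ x, u x = (if j = ⟨0, hk⟩ then z else 1) • x := by
    intro j
    let f : H j →ₗ[ℂ] H j := (if j = ⟨0, hk⟩ then z else 1) • 1
    have hf : ∀ a b, inner ℂ (f a) (f b) = inner ℂ a b := by
      intro a b
      simp only [f, LinearMap.smul_apply, Module.End.one_apply, inner_smul_left, inner_smul_right]
      split_ifs
      · linear_combination inner ℂ a b * hz
      · simp
    exact ⟨(f.isometryOfInner hf).toLinearIsometryEquiv rfl, fun _ => rfl⟩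
  choose g hg using h
  refine ⟨g, fun ψ => ?_⟩
  induction ψ using prodVec_induction with
  | prod x =>
    refine (PiTensorProduct.map_tprod _ x).trans ?_
    have e : (fun j => stdRep H j g (x j)) = fun j => (if j = ⟨0, hk⟩ then z else 1) • x j :=
      funext fun j => hg j (x j)
    refine (congrArg (PiTensorProduct.tprod ℂ) e).trans ?_
    rw [MultilinearMap.map_smul_univ, Finset.prod_ite_eq' Finset.univ (⟨0, hk⟩ : Fin k) fun _ => z,
      if_pos (Finset.mem_univ _)]
    rfl
  | smul c x h => rw [map_smul, h, smul_comm]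
  | add x y hx hy => rw [map_add, hx, hy, smul_add]

theorem exists_quartic_eq (hk : 1 ≤ k) {f : StateSpace H → ℂ} (hf : f ∈ invariantPolys e 4) :
    ∃ T, quartic H T = f := by
  obtain ⟨⟨P, hP, hfP⟩, hinv⟩ := hf
  -- a primitive cube root of unity
  let ω : ℂ := ⟨-1 / 2, √3 / 2⟩
  have hs : √3 * √3 = 3 := Real.mul_self_sqrt (by norm_num)
  have hω : 1 + ω + ω ^ 2 = 0 := by
    apply Complex.ext
    · simp [ω, sq]
      linear_combination -hs / 4
    · simp [ω, sq]
      ring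
  have hω' : starRingEnd ℂ ω = ω ^ 2 := by
    apply Complex.ext
    · simp [ω, sq]
      linear_combination hs / 4
    · simp [ω, sq]
      ring
  have h := cubeAverage_eval_mem e hω hω' hP
  have hfe : (fun ψ : StateSpace H => MvPolynomial.eval (coordVal e ψ) P) = f :=
    funext fun ψ => (hfP ψ).symm
  rw [hfe] at h
  obtain ⟨g, hg⟩ := exists_stateRep_eq_smul (H := H) hk (z := ω) (by
    rw [hω']
    linear_combination (ω - 1) * hω)
  rwa [cubeAverage_eq_self fun ψ => by rw [← hg, hinv]] at h

theorem invariant_mem_invariantPolys {A : Finset (Fin k)} (hA : Even A.card) :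
    (invariant A : StateSpace H → ℂ) ∈ invariantPolys e 4 := by
  refine ⟨?_, fun g ψ => quartic_invariant_of_commute (proj_comp_symRep A g) ψ⟩
  -- the two bilinear factors of `|∑_b ⋯|²`, in the coordinates and in their conjugates
  let Q (v : (∀ j, Fin (n j)) → (∀ j, Fin (n j)) ⊕ (∀ j, Fin (n j)))
      (p : (∀ j, Fin (n j)) × (∀ j, Fin (n j))) :
      MvPolynomial ((∀ j, Fin (n j)) ⊕ (∀ j, Fin (n j))) ℂ :=
    ∑ b, MvPolynomial.C (bitSign A b) * (MvPolynomial.X (v (pick p b)) *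
      MvPolynomial.X (v (pick p (flipBits b))))
  have hQ : ∀ v p, (Q v p).IsHomogeneous 2 := fun v p =>
    MvPolynomial.IsHomogeneous.sum _ _ _ fun b _ =>
      ((MvPolynomial.isHomogeneous_X _ _).mul (MvPolynomial.isHomogeneous_X _ _)).C_mul _
  refine ⟨MvPolynomial.C ((2 : ℂ) ^ k)⁻¹ *
    ∑ p : (∀ j, Fin (n j)) × (∀ j, Fin (n j)) with ∀ j, p.1 j ≤ p.2 j,
      MvPolynomial.C ((2 : ℂ) ^ agree p)⁻¹ * (Q Sum.inl p * Q Sum.inr p), ?_, fun ψ => ?_⟩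
  · exact (MvPolynomial.IsHomogeneous.sum _ _ _ fun p _ => ((hQ _ p).mul (hQ _ p)).C_mul _).C_mul _
  · rw [invariant_eq_invariantFormula e hA, invariantFormula]
    push_cast
    simp only [map_mul, map_sum, MvPolynomial.eval_C]
    congr 1
    refine Finset.sum_congr rfl fun p _ => ?_
    rw [← Complex.mul_conj']
    congr 1
    simp only [Q, map_sum, map_mul, MvPolynomial.eval_C, MvPolynomial.eval_X, Sum.elim_inl,
      Sum.elim_inr, conj_bitSign, mul_assoc]

theorem linearIndependent_invariant : LinearIndependent ℂ
    (fun A : {A : Finset (Fin k) // Even A.card ∧ (V H A).toSubmodule ≠ ⊥} =>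
      (invariant A.1 : StateSpace H → ℂ)) :=
  (linearIndependent_proj (H := H)).map' (quartic H) (LinearMap.ker_eq_bot.2 quartic_injective)

theorem span_invariant (hk : 1 ≤ k) : Submodule.span ℂ (Set.range
      (fun A : {A : Finset (Fin k) // Even A.card ∧ (V H A).toSubmodule ≠ ⊥} =>
        (invariant A.1 : StateSpace H → ℂ))) = invariantPolys e 4 := by
  apply le_antisymm
  · rw [Submodule.span_le]
    rintro _ ⟨A, rfl⟩
    exact invariant_mem_invariantPolys e A.2.1
  · intro f hf
    obtain ⟨T, rfl⟩ := exists_quartic_eq e hk hf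
    have hT := mem_span_proj_of_commute fun g => commute_of_quartic_invariant (hf.2 g)
    have h := Submodule.mem_map_of_mem (f := quartic H) hT
    rw [Submodule.map_span, ← Set.range_comp] at h
    exact h

theorem finrank_invariantPolys (hk : 1 ≤ k) : Module.finrank ℂ (invariantPolys e 4) =
    Nat.card {A : Finset (Fin k) // Even A.card ∧ (V H A).toSubmodule ≠ ⊥} := by
  classical
  rw [← span_invariant e hk, finrank_span_eq_card linearIndependent_invariant,
    Nat.card_eq_fintype_card]

theorem card_even_finset (hk : 1 ≤ k) :
    Nat.card {A : Finset (Fin k) // Even A.card} = 2 ^ (k - 1) := by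
  have h1 : ∑ A : Finset (Fin k), (1 + (-1 : ℤ) ^ A.card) = 2 ^ k := by
    rw [Finset.sum_add_distrib, ← Finset.powerset_univ, Finset.sum_powerset_neg_one_pow_card,
      if_neg (Finset.univ_nonempty_iff.2 ⟨⟨0, hk⟩⟩).ne_empty]
    simp
  have h2 : ∀ A : Finset (Fin k), 1 + (-1 : ℤ) ^ A.card = if Even A.card then 2 else 0 := by
    intro A
    split_ifs with h
    · rw [h.neg_one_pow]; norm_num
    · rw [(Nat.not_even_iff_odd.1 h).neg_one_pow]; norm_num
  rw [Finset.sum_congr rfl fun A _ => h2 A, ← Finset.sum_filter, Finset.sum_const] at h1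
  have h3 : (2 : ℤ) ^ k = 2 ^ (k - 1) * 2 := by rw [← pow_succ, Nat.sub_add_cancel hk]
  rw [Nat.card_eq_fintype_card, Fintype.card_subtype]
  rw [h3, nsmul_eq_mul] at h1
  exact_mod_cast mul_right_cancel₀ two_ne_zero h1

theorem finrank_invariantPolys_of_two_le (hk : 1 ≤ k) (hn : ∀ j, 2 ≤ n j) :
    Module.finrank ℂ (invariantPolys e 4) = 2 ^ (k - 1) := by
  rw [finrank_invariantPolys e hk, ← card_even_finset hk]
  refine Nat.card_congr (Equiv.subtypeEquivRight fun A => and_iff_left_of_imp fun hA => ?_)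
  exact (V_ne_bot_iff e hA).2 ⟨fun j => one_le_two.trans (hn j), fun j _ => hn j⟩

end

end LUInv

end

open LUInv in
theorem mainTheorem4 {k : ℕ} (hk : 1 ≤ k) {H : Fin k → Type*}
    [∀ j, NormedAddCommGroup (H j)] [∀ j, InnerProductSpace ℂ (H j)]
    [∀ j, FiniteDimensional ℂ (H j)] {n : Fin k → ℕ}
    (e : ∀ j, OrthonormalBasis (Fin (n j)) ℂ (H j)) :
    -- the components are tensor products of symmetric and exterior squares
    (∀ A : Finset (Fin k), Even A.card →
      ∃ φ : (factorRep H A).Equiv (V H A).toRepresentation,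
        ∀ t, regroup H (symIncl H (φ t)) = factorIncl H A t) ∧
    -- orthogonal direct sum decomposition
    (∀ A B : Finset (Fin k), Even A.card → Even B.card → A ≠ B →
      (V H A).toSubmodule ⟂ (V H B).toSubmodule) ∧
    DirectSum.IsInternal
      (fun A : {A : Finset (Fin k) // Even A.card} => (V H A.1).toSubmodule) ∧
    -- which components are present
    (∀ A : Finset (Fin k), Even A.card →
      ((V H A).toSubmodule ≠ ⊥ ↔ (∀ j, 1 ≤ n j) ∧ ∀ j ∈ A, 2 ≤ n j)) ∧
    -- they are irreducible and pairwise inequivalent, and there are no other irreducible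
    -- subrepresentations
    (∀ A : Finset (Fin k), Even A.card → (V H A).toSubmodule ≠ ⊥ →
      (V H A).toRepresentation.IsIrreducible) ∧
    (∀ A B : Finset (Fin k), Even A.card → Even B.card → (V H A).toSubmodule ≠ ⊥ →
      Nonempty ((V H A).toRepresentation.Equiv (V H B).toRepresentation) → A = B) ∧
    (∀ W : Subrepresentation (symRep H), W.toRepresentation.IsIrreducible →
      ∃! A : Finset (Fin k), Even A.card ∧ W = V H A) ∧
    -- every irreducible constituent has multiplicity one
    (∀ W : Subrepresentation (symRep H), W.toRepresentation.IsIrreducible →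
      Module.finrank ℂ (W.toRepresentation.IntertwiningMap (symRep H)) = 1) ∧
    -- the explicit orthogonal basis of each component
    (∀ A : Finset (Fin k), Even A.card →
      (∀ p : Admissible n A, basisVec e A p.1 ∈ (V H A).toSubmodule) ∧
      LinearIndependent ℂ (fun p : Admissible n A => basisVec e A p.1) ∧
      Submodule.span ℂ (Set.range fun p : Admissible n A => basisVec e A p.1) =
        (V H A).toSubmodule ∧
      (∀ p q : Admissible n A, p ≠ q → inner ℂ (basisVec e A p.1) (basisVec e A q.1) = 0) ∧
      (∀ p : Admissible n A, ‖basisVec e A p.1‖ ^ 2 = (2 : ℝ) ^ (k + agree p.1)) ∧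
      Module.finrank ℂ (V H A).toSubmodule =
        (∏ j ∈ Aᶜ, (n j + 1).choose 2) * ∏ j ∈ A, (n j).choose 2) ∧
    -- the explicit formula for the invariants
    (∀ A : Finset (Fin k), Even A.card → ∀ ψ : StateSpace H,
      invariant A ψ = (invariantFormula e A ψ : ℂ)) ∧
    -- the invariants of the nonzero components form a basis of the space of all LU-invariants
    -- of degree four
    LinearIndependent ℂ
      (fun A : {A : Finset (Fin k) // Even A.card ∧ (V H A).toSubmodule ≠ ⊥} =>
        (invariant A.1 : StateSpace H → ℂ)) ∧
    Submodule.span ℂ (Set.range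
      (fun A : {A : Finset (Fin k) // Even A.card ∧ (V H A).toSubmodule ≠ ⊥} =>
        (invariant A.1 : StateSpace H → ℂ))) = invariantPolys e 4 ∧
    -- the dimension of that space
    Module.finrank ℂ (invariantPolys e 4) =
      Nat.card {A : Finset (Fin k) // Even A.card ∧ (V H A).toSubmodule ≠ ⊥} ∧
    ((∀ j, 2 ≤ n j) → Module.finrank ℂ (invariantPolys e 4) = 2 ^ (k - 1)) := by
  refine ⟨fun A hA => exists_factorRep_equiv hA, fun A B hA hB hAB => V_isOrtho hA hB hAB,
    isInternal_V, fun A hA => V_ne_bot_iff e hA, fun A _ hV => V_isIrreducible hV,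
    fun A B hA hB hV ⟨φ⟩ => eq_of_equiv_V hA hB hV φ, fun W hW => ?_, fun W hW => ?_,
    fun A hA => ?_,
    fun A hA ψ => invariant_eq_invariantFormula e hA ψ, linearIndependent_invariant,
    span_invariant e hk, finrank_invariantPolys e hk, finrank_invariantPolys_of_two_le e hk⟩
  · obtain ⟨A, hA, hV, rfl⟩ := exists_eq_V_of_isIrreducible W hW
    exact ⟨A, ⟨hA, rfl⟩, fun B hB => (V_injective hA hB.1 hV hB.2).symm⟩
  · obtain ⟨A, hA, hV, rfl⟩ := exists_eq_V_of_isIrreducible W hW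
    exact finrank_intertwiningMap_V hV
  · exact ⟨fun p => basisVec_mem e hA p.1, linearIndependent_basisVec e hA, (V_eq_span e hA).symm,
      fun p q hpq => inner_basisVec_admissible e hA hpq,
      fun p => norm_sq_basisVec e hA (fun j => (p.2 j).1) (fun j => (p.2 j).2), finrank_V e hA⟩
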